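/- **Proposition 4.8.** Let $S^1=\mathbb R/\mathbb Z$ and let $(\theta,\rho,\phi)$ be cylindrical polar coordinates on $M=S^1\times\mathbb R^2$ (with $\phi\in\mathbb R/2\pi\mathbb Z$). Let $f,g:[0,\infty)\to\mathbb R$ be such that $(\rho,\phi)\mapsto f(\rho)$ and $(\rho,\phi)\mapsto g(\rho)/\rho^2$ define smooth functions on $\mathbb R^2$, and such that $D(\rho):=f(\rho)g'(\rho)-f'(\rho)g(\rho)>0$ for all $\rho>0$ and $f(0)g''(0)>0$, so that $\lambda=f(\rho)\,d\theta+g(\rho)\,d\phi$ is a positive contact form on $M$. Then $\lambda$ has a unique Reeb vector field $X$ (that is, $\lambda(X)\equiv1$ and $d\lambda(X,\cdot)\equiv0$), and $X$ has a unique globally defined flow $\varphi^t$. Put $\xi=\ker\lambda$. (1) Suppose $r>0$ and $f'(r)/(2\pi g'(r))=p/q\in\mathbb Q\cup\{\infty\}$ for relatively prime integers $p,q$ whose signs match those of $f'(r)$ and $g'(r)$ respectively (so $p=0$ iff $f'(r)=0$, and $q=0$ iff $g'(r)=0$). Then $L_r:=\{\rho=r\}$ is an embedded torus foliated by closed orbits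 of $X$ of the form $$x(t)=\Bigl(\theta_0+\tfrac{g'(r)}{D(r)}t,\ r,\ \phi_0-\tfrac{f'(r)}{D(r)}t\Bigr)=\Bigl(\theta_0+\tfrac qT t,\ r,\ \phi_0-\tfrac{2\pi p}{T}t\Bigr),$$ all having minimal period $$T=q\frac{D(r)}{g'(r)}=2\pi p\frac{D(r)}{f'(r)}>0$$ (if $f'(r)=p=0$ or $g'(r)=q=0$, only the expression that makes sense is meant). (2) In the situation of (1), $L_r$ is Morse-Bott if and only if the function $\rho\mapsto f'(\rho)/g'(\rho)$ (if $g'(r)\neq0$), respectively $\rho\mapsto g'(\rho)/f'(\rho)$ (if $f'(r)\ne0$), has nonvanishing derivative at $r$. Here an embedded torus $N\subset M$ tangent to $X$ is called Morse-Bott if for some $T'>0$ one has $\varphi^{T'}|_N=\mathrm{id}$ and $T_mN=\ker(d\varphi^{T'}(m)-\mathrm{id})$ for all $m\in N$. (3) The circle $P:=\{\rho=0\}$ is a closed orbit of $X$ with minimal period $|f(0)|$. For every integer $k\ge1$, its $k$-fold cover $P^k$ (the same orbit with period $k|f(0)|$) is degenerate, meaning that $d\varphi^{k|f(0)|}|_{\xi}$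 has the eigenvalue $1$ at the points of $P$, if and only if $\frac{k f''(0)}{2\pi g''(0)}\in\mathbb Z$; otherwise $$\mu_{\mathrm{CZ}}^{\Phi_0}(P^k)=2\left\lfloor-\frac{k f''(0)}{2\pi g''(0)}\right\rfloor+1,$$ where $\mu_{\mathrm{CZ}}$ is the Conley-Zehnder index, $\Phi_0$ is the symplectic trivialization of $(\xi,d\lambda)$ along $P$ induced by the Cartesian coordinates $(x,y)$ of $\mathbb R^2$, namely the frame $\bigl(\partial_x,\operatorname{sgn}(g''(0))\,\partial_y\bigr)/\sqrt{|g''(0)|}$, and $\lfloor\cdot\rfloor$ is the greatest integer function. -/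

import Mathlib

open Set Filter Topology
open scoped ContDiff

noncomputable section

namespace SymOrbits

/-! ### Calculus on `M = S¹ × ℝ²`, `S¹ = ℝ / ℤ`

`M` is an abelian Lie group with Lie algebra `ℝ × ℝ × ℝ` and exponential map `expM`, which is
the universal covering. All tangent spaces of `M` are identified with `ℝ × ℝ × ℝ` through the
global frame `∂_θ, ∂_x, ∂_y`, and near a point `m` the map `h ↦ m + expM h` is (the inverse of)
a chart that induces this identification. -/

/-- The tangent space of `M` at any point, in the frame `∂_θ, ∂_x, ∂_y`. -/
abbrev TM := ℝ × ℝ × ℝ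

/-- `S¹ × ℝ²` with coordinates `(θ, x, y)`, where `θ ∈ ℝ / ℤ`. -/
abbrev M := AddCircle (1 : ℝ) × ℝ × ℝ

/-- The universal covering `ℝ × ℝ² → S¹ × ℝ²`. -/
def expM (h : TM) : M := ((h.1 : AddCircle (1 : ℝ)), h.2.1, h.2.2)

/-- The curve `γ` in `M` has velocity `v` at time `t`. -/
def HasVelocityAt (γ : ℝ → M) (v : TM) (t : ℝ) : Prop :=
  ∃ c : ℝ → TM, c t = 0 ∧ HasDerivAt c v t ∧ ∀ᶠ s in 𝓝 t, γ s = γ t + expM (c s)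

/-- The map `F : M → M` is differentiable at `m` with differential `A : T_m M → T_{F m} M`. -/
def HasDifferentialAt (F : M → M) (A : TM →L[ℝ] TM) (m : M) : Prop :=
  ∃ Fl : TM → TM, Fl 0 = 0 ∧ HasFDerivAt Fl A 0 ∧
    ∀ᶠ h in 𝓝 (0 : TM), F (m + expM h) = F m + expM (Fl h)

/-- Exterior derivative of a `1`-form `α`: `dα(u, v) = u(α(v)) - v(α(u))` for constant `u, v`. -/
def dForm (α : M → TM →L[ℝ] ℝ) (m : M) (u v : TM) : ℝ :=
  fderiv ℝ (fun h : TM => α (m + expM h)) 0 u v - fderiv ℝ (fun h : TM => α (m + expM h)) 0 v u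

/-- Tangent vectors at `m` to a subset `N` of `M`: velocities of curves in `N` through `m`. -/
def tangentVectors (N : Set M) (m : M) : Set TM :=
  {v | ∃ γ : ℝ → M, γ 0 = m ∧ (∀ t, γ t ∈ N) ∧ HasVelocityAt γ v 0}

/-- `N` is a smoothly embedded two-dimensional torus in `M`: near each of its points it is a
regular level set of a smooth function, and it is homeomorphic to `S¹ × S¹`. -/
def IsEmbeddedTorus (N : Set M) : Prop :=
  (∀ m ∈ N, ∃ F : TM → ℝ, ContDiff ℝ ∞ F ∧ fderiv ℝ F 0 ≠ 0 ∧
    ∀ᶠ h in 𝓝 (0 : TM), m + expM h ∈ N ↔ F h = 0) ∧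
  Nonempty (N ≃ₜ AddCircle (1 : ℝ) × AddCircle (1 : ℝ))

/-! ### Reeb dynamics -/

/-- `X` is the Reeb vector field of `α`. -/
def IsReebField (α : M → TM →L[ℝ] ℝ) (X : M → TM) : Prop :=
  ∀ m, α m (X m) = 1 ∧ ∀ v, dForm α m (X m) v = 0

/-- `γ` is an orbit (a globally defined integral curve) of the vector field `X`. -/
def IsOrbit (X : M → TM) (γ : ℝ → M) : Prop :=
  ∀ t, HasVelocityAt γ (X (γ t)) t

/-- `φ t` is the time-`t` flow of the vector field `X`. -/
def IsFlow (X : M → TM) (φ : ℝ → M → M) : Prop :=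
  ∀ m, φ 0 m = m ∧ IsOrbit X (fun t => φ t m)

/-- `T > 0` is the minimal period of the curve `γ`. -/
def IsMinimalPeriod (γ : ℝ → M) (T : ℝ) : Prop :=
  0 < T ∧ Function.Periodic γ T ∧ ∀ S, 0 < S → Function.Periodic γ S → T ≤ S

/-- `N` is a Morse-Bott torus for the vector field `X` with flow `φ`: it is tangent to `X`, and for
some `T > 0` the time-`T` flow fixes `N` pointwise and `T_m N = ker (dφ^T(m) - 1)` on `N`. -/
def IsMorseBottTorus (X : M → TM) (φ : ℝ → M → M) (N : Set M) : Prop :=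
  IsEmbeddedTorus N ∧ (∀ m ∈ N, X m ∈ tangentVectors N m) ∧
  ∃ T : ℝ, 0 < T ∧ ∀ m ∈ N, φ T m = m ∧
    ∃ A : TM →L[ℝ] TM, HasDifferentialAt (φ T) A m ∧ tangentVectors N m = {v | A v = v}

/-- The `T`-periodic orbit through `m` of the flow `φ` of the Reeb field of `α` is degenerate:
`1` is an eigenvalue of the linearized return map restricted to the contact plane `ker α`. -/
def IsDegenerate (α : M → TM →L[ℝ] ℝ) (φ : ℝ → M → M) (m : M) (T : ℝ) : Prop :=
  ∃ A : TM →L[ℝ] TM, HasDifferentialAt (φ T) A m ∧ ∃ v : TM, α m v = 0 ∧ v ≠ 0 ∧ A v = v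

/-! ### The Conley-Zehnder index -/

/-- The set of total winding numbers `(arg Ψ(T)z - arg Ψ(0)z) / 2π` of the vectors `Ψ(t) z`,
`0 ≤ t ≤ T`, for `z ≠ 0` in `ℝ²`. The argument `a` is continuous along the path. -/
def windingSet (Ψ : ℝ → Matrix (Fin 2) (Fin 2) ℝ) (T : ℝ) : Set ℝ :=
  {w | ∃ z : Fin 2 → ℝ, z ≠ 0 ∧ ∃ s a : ℝ → ℝ, ContinuousOn a (Icc 0 T) ∧
    (∀ t ∈ Icc 0 T, 0 < s t ∧
      (Ψ t).mulVec z = ![s t * Real.cos (a t), s t * Real.sin (a t)]) ∧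
    w = (a T - a 0) / (2 * Real.pi)}

/-- `Ψ` is a continuous path in `Sp(2, ℝ) = SL(2, ℝ)` on `[0, T]` that starts at the identity and
ends at a matrix without eigenvalue `1`, and its Conley-Zehnder index is `μ`. The winding numbers
form a compact interval of length less than `1/2`; the index is `2 k` if this interval contains
the integer `k`, and `2 k + 1` if it lies strictly between `k` and `k + 1`. -/
def IsCZIndexOfPath (Ψ : ℝ → Matrix (Fin 2) (Fin 2) ℝ) (T : ℝ) (μ : ℤ) : Prop :=
  ContinuousOn Ψ (Icc 0 T) ∧ Ψ 0 = 1 ∧ (∀ t ∈ Icc 0 T, (Ψ t).det = 1) ∧ (Ψ T - 1).det ≠ 0 ∧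
  ∃ k : ℤ, ((k : ℝ) ∈ windingSet Ψ T ∧ μ = 2 * k) ∨
    (windingSet Ψ T ⊆ Ioo (k : ℝ) (k + 1) ∧ μ = 2 * k + 1)

/-- `e` is a symplectic trivialization of `(ker α, dα)` along the `T`-periodic curve `γ`. -/
def IsSymplecticFrame (α : M → TM →L[ℝ] ℝ) (γ : ℝ → M) (T : ℝ) (e : ℝ → Fin 2 → TM) : Prop :=
  Continuous e ∧ Function.Periodic e T ∧
  ∀ t, (∀ i, α (γ t) (e t i) = 0) ∧ dForm α (γ t) (e t 0) (e t 1) = 1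

/-- The `T`-periodic orbit `t ↦ φ t m` of the Reeb flow `φ` of `α` is closed and nondegenerate, and
has Conley-Zehnder index `μ` with respect to the symplectic trivialization `e`. Here `Ψ t` is the
matrix of `dφ^t(m) : ξ_m → ξ_{φ t m}` in the frame `e`. -/
def HasCZIndex (α : M → TM →L[ℝ] ℝ) (φ : ℝ → M → M) (m : M) (T : ℝ) (e : ℝ → Fin 2 → TM)
    (μ : ℤ) : Prop :=
  0 < T ∧ Function.Periodic (fun t => φ t m) T ∧
  IsSymplecticFrame α (fun t => φ t m) T e ∧
  ∃ Ψ : ℝ → Matrix (Fin 2) (Fin 2) ℝ,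
    (∀ t ∈ Icc 0 T, ∃ A : TM →L[ℝ] TM, HasDifferentialAt (φ t) A m ∧
      ∀ j, A (e 0 j) = ∑ i, Ψ t i j • e t i) ∧
    IsCZIndexOfPath Ψ T μ

/-! ### The rotationally symmetric contact form -/

/-- The radius `ρ`. -/
def radius (m : M) : ℝ := √(m.2.1 ^ 2 + m.2.2 ^ 2)

/-- The `1`-form `f(ρ) dθ + g(ρ) dφ`, where `dφ = (x dy - y dx) / ρ²`. At `ρ = 0` the second term is
zero, which is its smooth extension when `g(ρ) / ρ²` is smooth. -/
def symForm (f g : ℝ → ℝ) (m : M) : TM →L[ℝ] ℝ :=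
  f (radius m) • ContinuousLinearMap.fst ℝ ℝ (ℝ × ℝ) +
    (g (radius m) / radius m ^ 2) •
      (m.2.1 • (ContinuousLinearMap.snd ℝ ℝ ℝ).comp (ContinuousLinearMap.snd ℝ ℝ (ℝ × ℝ)) -
        m.2.2 • (ContinuousLinearMap.fst ℝ ℝ ℝ).comp (ContinuousLinearMap.snd ℝ ℝ (ℝ × ℝ)))

/-- `(ρ, φ) ↦ u(ρ)` is a smooth function on `ℝ²`. Only the values `u ρ`, `ρ ≥ 0`, matter. -/
def RadiallySmooth (u : ℝ → ℝ) : Prop :=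
  ContDiff ℝ ∞ (fun z : ℝ × ℝ => u (√(z.1 ^ 2 + z.2 ^ 2)))

/-- The Wronskian `D = f g' - f' g`. -/
def wronskian (f g : ℝ → ℝ) (ρ : ℝ) : ℝ := f ρ * deriv g ρ - deriv f ρ * g ρ

/-- The second derivative at `0` of a function on `[0, ∞)`. -/
def secondDerivZero (u : ℝ → ℝ) : ℝ := iteratedDerivWithin 2 u (Ici 0) 0

/-- The data `f, g` define a smooth positive contact form `f(ρ) dθ + g(ρ) dφ` on `M`. -/
structure IsContactData (f g : ℝ → ℝ) : Prop where
  smooth_f : RadiallySmooth f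
  smooth_g : ∃ h : ℝ → ℝ, RadiallySmooth h ∧ ∀ ρ, 0 ≤ ρ → g ρ = ρ ^ 2 * h ρ
  wronskian_pos : ∀ ρ, 0 < ρ → 0 < wronskian f g ρ
  center_pos : 0 < f 0 * secondDerivZero g

/-- `{ρ = r}`: a torus for `r > 0`, and the central circle for `r = 0`. -/
def level (r : ℝ) : Set M := {m | radius m = r}

/-- The curve `t ↦ (θ₀ + a t, r, φ₀ + b t)` in cylindrical polar coordinates `(θ, ρ, φ)`. -/
def polarLine (r θ₀ φ₀ a b : ℝ) (t : ℝ) : M :=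
  (((θ₀ + a * t : ℝ) : AddCircle (1 : ℝ)), r * Real.cos (φ₀ + b * t), r * Real.sin (φ₀ + b * t))

/-- The frame `(∂_x / √|c|, sgn(c) ∂_y / √|c|)`. It is the symplectic trivialization of the contact
planes along `{ρ = 0}` induced by the coordinates when `c = g''(0)`, as then
`dλ(∂_x, ∂_y) = c` there. -/
def coordFrame (c : ℝ) : ℝ → Fin 2 → TM :=
  fun _ => ![(0, 1 / √|c|, 0), (0, 0, √|c| / c)]

end SymOrbits

end

namespace SymOrbits

/-! ### Curves and differentials in `M` -/

/-! Off the axis the Reeb equations give X = (g' ∂_θ - f' ∂_φ)/D. Dividing f', g' and D by ρ makes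
the coefficients `reebA` and `reebB` meaningful at ρ = 0: f and g extend to even smooth functions,
so f'/ρ and g'/ρ extend by the second derivatives, and D/ρ tends to f(0)g''(0) > 0. In Cartesian
coordinates the linear algebra never divides by ρ, so `isReebField_iff` treats axis and complement
together.

The coefficients a = `reebA`, b = `reebB` depend on ρ only, and X is tangent to the tori. Hence ρ is
conserved, X is linear on each torus, and the flow is the explicit `rotFlow`; `IsOrbit.eq_rotFlow`
gives uniqueness. Periods on a torus then reduce to Bezout's identity.

Off the axis the linearized flow is a rotation plus a shear t(dρ)(a' ∂_θ - b' ∂_φ). Once the flow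
fixes the torus the rotation is trivial, so the torus is Morse-Bott iff (a', b') ≠ 0
(`isMorseBottTorus_level_iff`). Differentiating λ(X) = fa - gb = 1 and using f'a = g'b gives fa' -
gb' = 0; together these relations make (a', b') = 0 equivalent to the vanishing of the derivative of
b/a, or of a/b (`deriv_quotient_ne_zero_iff`).

On the axis the linearized flow on ξ is a rotation with constant angular velocity. All vectors wind
by the same amount (`windingSet_rotMatrix_subset`), so 1 is an eigenvalue iff that amount is an
integer, and otherwise the index is read off from its floor. -/

@[simp] lemma expM_zero : expM 0 = 0 := by simp [expM]

lemma expM_sub (u v : TM) : expM (u - v) = expM u - expM v := by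
  simp [expM]
  rfl

/-- The kernel of the covering is ℤ × 0, which meets the strip |θ| < 1 only at the origin. -/
lemma eq_zero_of_expM_eq_zero {u : TM} (hu : expM u = 0) (hn : |u.1| < 1) : u = 0 := by
  obtain ⟨t, x, y⟩ := u
  simp only [expM, Prod.mk_eq_zero] at hu
  obtain ⟨ht, hx, hy⟩ := hu
  obtain ⟨n, hn'⟩ := (AddCircle.coe_eq_zero_iff (1 : ℝ)).1 ht
  have h1 : ((n : ℤ) : ℝ) = t := by simpa using hn'
  have h2 : |n| < 1 := by
    have : |(n : ℝ)| < 1 := by rw [h1]; exact hn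
    exact_mod_cast this
  have h3 : n = 0 := Int.abs_lt_one_iff.1 h2
  subst h3
  simp_all

lemma hasVelocityAt_of_lift {γ : ℝ → M} {Γ : ℝ → TM} {v : TM} {t : ℝ}
    (h : ∀ s, γ s = expM (Γ s)) (hΓ : HasDerivAt Γ v t) : HasVelocityAt γ v t := by
  refine ⟨fun s => Γ s - Γ t, by simp, by simpa using hΓ.sub_const (Γ t),
    Eventually.of_forall fun s => ?_⟩
  rw [h, h, expM_sub]
  abel

lemma HasVelocityAt.hasDerivAt_snd {γ : ℝ → M} {v : TM} {t : ℝ} (h : HasVelocityAt γ v t) :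
    HasDerivAt (fun s => (γ s).2) v.2 t := by
  obtain ⟨c, _, hc, he⟩ := h
  have h1 : HasDerivAt (fun s => (γ t).2 + (c s).2) v.2 t :=
    (HasFDerivAt.comp_hasDerivAt t (ContinuousLinearMap.snd ℝ ℝ (ℝ × ℝ)).hasFDerivAt hc).const_add _
  refine h1.congr_of_eventuallyEq ?_
  filter_upwards [he] with s hs
  rw [hs]
  rfl

lemma HasVelocityAt.hasDerivAt_x {γ : ℝ → M} {v : TM} {t : ℝ} (h : HasVelocityAt γ v t) :
    HasDerivAt (fun s => (γ s).2.1) v.2.1 t :=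
  HasFDerivAt.comp_hasDerivAt t (ContinuousLinearMap.fst ℝ ℝ ℝ).hasFDerivAt h.hasDerivAt_snd

lemma HasVelocityAt.hasDerivAt_y {γ : ℝ → M} {v : TM} {t : ℝ} (h : HasVelocityAt γ v t) :
    HasDerivAt (fun s => (γ s).2.2) v.2.2 t :=
  HasFDerivAt.comp_hasDerivAt t (ContinuousLinearMap.snd ℝ ℝ ℝ).hasFDerivAt h.hasDerivAt_snd

/-- The coordinate θ is not real-valued, so its motion is recorded by exp(2πiθ), to which calculus
in ℂ applies. -/
lemma HasVelocityAt.hasDerivAt_toCircle {γ : ℝ → M} {v : TM} {t : ℝ} (h : HasVelocityAt γ v t) :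
    HasDerivAt (fun s => ((γ s).1.toCircle : ℂ))
      (((γ t).1.toCircle : ℂ) * (2 * Real.pi * v.1 * Complex.I)) t := by
  obtain ⟨c, h0, hc, he⟩ := h
  have h1 : HasDerivAt (fun s => (c s).1) v.1 t :=
    HasFDerivAt.comp_hasDerivAt t (ContinuousLinearMap.fst ℝ ℝ (ℝ × ℝ)).hasFDerivAt hc
  have h2 : HasDerivAt (fun s => ((γ t).1.toCircle : ℂ) *
      Complex.exp (2 * Real.pi * ((c s).1 : ℂ) * Complex.I))
      (((γ t).1.toCircle : ℂ) * (Complex.exp (2 * Real.pi * ((c t).1 : ℂ) * Complex.I) *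
        (2 * Real.pi * v.1 * Complex.I))) t :=
    (((h1.ofReal_comp.const_mul (2 * Real.pi : ℂ)).mul_const Complex.I).cexp).const_mul _
  rw [h0] at h2
  simp only [Prod.fst_zero, Complex.ofReal_zero, mul_zero, zero_mul, Complex.exp_zero,
    one_mul] at h2
  refine h2.congr_of_eventuallyEq ?_
  filter_upwards [he] with s hs
  rw [hs]
  simp [expM, AddCircle.toCircle_add, AddCircle.toCircle_apply_mk, Circle.coe_exp]

/-- Two lifts differ by a map into the kernel of `expM` that is small near 0, hence zero there. This
lets the existential differentials in the Morse-Bott and degeneracy conditions be replaced by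
computed ones. -/
lemma HasDifferentialAt.unique {F : M → M} {A B : TM →L[ℝ] TM} {m : M}
    (hA : HasDifferentialAt F A m) (hB : HasDifferentialAt F B m) : A = B := by
  obtain ⟨F₁, h₁, d₁, e₁⟩ := hA
  obtain ⟨F₂, h₂, d₂, e₂⟩ := hB
  have hd := d₁.sub d₂
  have hc : Tendsto (fun h => |((F₁ - F₂) h).1|) (𝓝 0) (𝓝 0) := by
    have := (hd.continuousAt.fst).abs
    simpa [ContinuousAt, h₁, h₂] using this
  have he : (F₁ - F₂) =ᶠ[𝓝 0] fun _ => (0 : TM) := by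
    filter_upwards [e₁, e₂, hc.eventually (gt_mem_nhds one_pos)] with h k₁ k₂ k₃
    refine eq_zero_of_expM_eq_zero ?_ k₃
    rw [Pi.sub_apply, expM_sub, sub_eq_zero]
    exact add_left_cancel (k₁.symm.trans k₂)
  have := hd.unique ((hasFDerivAt_const (0 : TM) (0 : TM)).congr_of_eventuallyEq he)
  exact sub_eq_zero.1 this

/-! ### The radius function -/

lemma radius_nonneg (m : M) : 0 ≤ radius m := Real.sqrt_nonneg _

lemma radius_sq (m : M) : radius m ^ 2 = m.2.1 ^ 2 + m.2.2 ^ 2 := Real.sq_sqrt (by positivity)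

lemma radius_eq_iff {m : M} {r : ℝ} (hr : 0 ≤ r) :
    radius m = r ↔ m.2.1 ^ 2 + m.2.2 ^ 2 = r ^ 2 := by
  rw [← radius_sq]
  exact (sq_eq_sq₀ (radius_nonneg m) hr).symm

lemma radius_eq_zero_iff {m : M} : radius m = 0 ↔ m.2 = 0 := by
  rw [radius_eq_iff le_rfl, Prod.ext_iff]
  constructor
  · intro h
    exact ⟨by simp; nlinarith [sq_nonneg m.2.1, sq_nonneg m.2.2],
      by simp; nlinarith [sq_nonneg m.2.1, sq_nonneg m.2.2]⟩
  · rintro ⟨h1, h2⟩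
    simp at h1 h2
    simp [h1, h2]

/-! ### Lines in polar coordinates and the tori `ρ = r` -/

lemma hasVelocityAt_polarLine (r θ₀ φ₀ a b t : ℝ) :
    HasVelocityAt (polarLine r θ₀ φ₀ a b)
      (a, -b * (polarLine r θ₀ φ₀ a b t).2.2, b * (polarLine r θ₀ φ₀ a b t).2.1) t := by
  refine hasVelocityAt_of_lift
    (Γ := fun s => (θ₀ + a * s, r * Real.cos (φ₀ + b * s), r * Real.sin (φ₀ + b * s)))
    (fun s => rfl) ?_
  have h (k l : ℝ) : HasDerivAt (fun s => k + l * s) l t := by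
    simpa using ((hasDerivAt_id t).const_mul l).const_add k
  refine (h θ₀ a).prodMk (((h φ₀ b).cos.const_mul r).prodMk ((h φ₀ b).sin.const_mul r)) |>.congr_deriv ?_
  simp only [polarLine, Prod.mk.injEq, true_and]
  constructor <;> ring

lemma polarLine_mem_level {r : ℝ} (hr : 0 ≤ r) (θ₀ φ₀ a b t : ℝ) :
    polarLine r θ₀ φ₀ a b t ∈ level r := by
  rw [level, mem_ofPred_eq, radius_eq_iff hr]
  simp only [polarLine]
  linear_combination r ^ 2 * Real.sin_sq_add_cos_sq (φ₀ + b * t)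

lemma exists_polar_of_mem_level {r : ℝ} {m : M} (hm : m ∈ level r) :
    ∃ θ₀ φ₀ : ℝ, ∀ a b, polarLine r θ₀ φ₀ a b 0 = m := by
  obtain ⟨θ, x, y⟩ := m
  obtain ⟨t, rfl⟩ := QuotientAddGroup.mk_surjective θ
  have hn : ‖(⟨x, y⟩ : ℂ)‖ = r := by
    rw [← hm, Complex.norm_def, Complex.normSq_mk, radius]
    simp only [pow_two]
  refine ⟨t, (⟨x, y⟩ : ℂ).arg, fun a b => ?_⟩
  have h1 := Complex.norm_mul_cos_arg ⟨x, y⟩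
  have h2 := Complex.norm_mul_sin_arg ⟨x, y⟩
  rw [hn] at h1 h2
  simp only [polarLine, mul_zero, add_zero, h1, h2]

lemma tangentVectors_level {r : ℝ} (hr : 0 < r) {m : M} (hm : m ∈ level r) :
    tangentVectors (level r) m = {v | m.2.1 * v.2.1 + m.2.2 * v.2.2 = 0} := by
  ext v
  constructor
  · rintro ⟨γ, h0, hγ, hv⟩
    have h1 := (hv.hasDerivAt_x.pow 2).add (hv.hasDerivAt_y.pow 2)
    have h2 : (fun s => (γ s).2.1) ^ 2 + (fun s => (γ s).2.2) ^ 2 = fun _ : ℝ => r ^ 2 := by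
      ext s
      exact (radius_eq_iff hr.le).1 (hγ s)
    rw [h2] at h1
    have h3 := h1.unique (hasDerivAt_const 0 (r ^ 2))
    rw [h0] at h3
    simp only [mem_ofPred_eq]
    norm_num at h3
    linarith
  · intro hv
    obtain ⟨θ₀, φ₀, hp⟩ := exists_polar_of_mem_level hm
    have hm2 := (radius_eq_iff hr.le).1 hm
    have hr2 : r ^ 2 ≠ 0 := by positivity
    -- The angular component dφ(v): a vector without radial part is the velocity of the polar line
    -- with speeds `v.1` and dφ(v).
    set b := (m.2.1 * v.2.2 - m.2.2 * v.2.1) / r ^ 2 with hb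
    refine ⟨polarLine r θ₀ φ₀ v.1 b, hp _ _, fun t => polarLine_mem_level hr.le _ _ _ _ _, ?_⟩
    have := hasVelocityAt_polarLine r θ₀ φ₀ v.1 b 0
    rw [hp] at this
    convert this using 1
    obtain ⟨v1, v2, v3⟩ := v
    simp only [mem_ofPred_eq] at hv
    simp only [Prod.mk.injEq, true_and, hb]
    constructor
    · field_simp
      linear_combination -v2 * hm2 + m.2.1 * hv
    · field_simp
      linear_combination -v3 * hm2 + m.2.2 * hv

/-- The parametrization of the torus `ρ = r` by `S¹ × S¹`. -/
noncomputable def torusEquiv {r : ℝ} (hr : 0 < r) :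
    AddCircle (1 : ℝ) × AddCircle (1 : ℝ) ≃ level r :=
  Equiv.ofBijective
    (fun p => ⟨(p.1, r * (p.2.toCircle : ℂ).re, r * (p.2.toCircle : ℂ).im), by
      rw [level, mem_ofPred_eq, radius_eq_iff hr.le]
      have := Complex.normSq_apply (p.2.toCircle : ℂ)
      rw [Circle.normSq_coe] at this
      linear_combination -r ^ 2 * this⟩) (by
    constructor
    · rintro ⟨p1, p2⟩ ⟨q1, q2⟩ h
      simp only [Subtype.mk.injEq, Prod.mk.injEq, mul_eq_mul_left_iff, hr.ne', or_false] at h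
      obtain ⟨h1, h2, h3⟩ := h
      rw [h1, AddCircle.injective_toCircle one_ne_zero (Circle.ext (Complex.ext h2 h3))]
    · rintro ⟨m, hm⟩
      obtain ⟨θ₀, φ₀, hp⟩ := exists_polar_of_mem_level hm
      refine ⟨(θ₀, ((φ₀ / (2 * Real.pi) : ℝ) : AddCircle (1 : ℝ))), ?_⟩
      rw [Subtype.mk.injEq, ← hp 0 0]
      have h : 2 * Real.pi * (φ₀ / (2 * Real.pi)) = φ₀ := by field_simp
      simp [AddCircle.toCircle_apply_mk, Circle.coe_exp, polarLine, h, Complex.exp_ofReal_mul_I_re,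
        Complex.exp_ofReal_mul_I_im, -Complex.ofReal_div, -Complex.ofReal_mul])

lemma continuous_torusEquiv {r : ℝ} (hr : 0 < r) : Continuous (torusEquiv hr) := by
  refine Continuous.subtype_mk ?_ _
  have h : Continuous fun p : AddCircle (1 : ℝ) × AddCircle (1 : ℝ) => (p.2.toCircle : ℂ) :=
    continuous_subtype_val.comp (AddCircle.continuous_toCircle.comp continuous_snd)
  exact continuous_fst.prodMk ((continuous_const.mul (Complex.continuous_re.comp h)).prodMk
    (continuous_const.mul (Complex.continuous_im.comp h)))

lemma isEmbeddedTorus_level {r : ℝ} (hr : 0 < r) : IsEmbeddedTorus (level r) := by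
  refine ⟨fun m hm => ?_, ⟨((continuous_torusEquiv hr).homeoOfEquivCompactToT2).symm⟩⟩
  refine ⟨fun h => (m.2.1 + h.2.1) ^ 2 + (m.2.2 + h.2.2) ^ 2 - r ^ 2, by fun_prop, ?_,
    Eventually.of_forall fun h => ?_⟩
  · intro h0
    have hd : DifferentiableAt ℝ (fun h : TM => (m.2.1 + h.2.1) ^ 2 + (m.2.2 + h.2.2) ^ 2 - r ^ 2) 0 := by
      fun_prop
    have h1 := hd.hasFDerivAt
    rw [h0] at h1
    -- The differential is tested on the radial direction, along which the function is (1 + s)²r² -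
    -- r², with derivative 2r² at 0.
    have h2 : HasDerivAt (fun s : ℝ => s • ((0, m.2) : TM)) ((1 : ℝ) • ((0, m.2) : TM)) 0 :=
      (hasDerivAt_id (0 : ℝ)).smul_const _
    have h3 := HasFDerivAt.comp_hasDerivAt_of_eq 0 h1 h2 (by simp)
    have h4 : HasDerivAt (fun s : ℝ => (1 + s) ^ 2 * r ^ 2 - r ^ 2) (2 * r ^ 2) 0 := by
      have := ((((hasDerivAt_id (0 : ℝ)).const_add 1).pow 2).mul_const (r ^ 2)).sub_const (r ^ 2)
      refine this.congr_deriv ?_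
      simp
    have h5 : (fun s : ℝ => (1 + s) ^ 2 * r ^ 2 - r ^ 2) =
        (fun h : TM => (m.2.1 + h.2.1) ^ 2 + (m.2.2 + h.2.2) ^ 2 - r ^ 2) ∘
          fun s : ℝ => s • ((0, m.2) : TM) := by
      ext s
      simp only [Function.comp, Prod.smul_mk, Prod.smul_fst, Prod.smul_snd, smul_eq_mul]
      linear_combination -(1 + s) ^ 2 * (radius_eq_iff hr.le).1 hm
    rw [h5] at h4
    have h6 := h4.unique h3
    simp at h6
    exact hr.ne' h6
  · rw [level, mem_ofPred_eq, radius_eq_iff hr.le, sub_eq_zero]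
    rfl

end SymOrbits

namespace SymOrbits

/-! ### Rotationally symmetric vector fields tangent to the tori `ρ = r` -/

/-- The vector field `a(ρ) ∂_θ - b(ρ) ∂_φ`. -/
noncomputable def rotField (a b : ℝ → ℝ) (m : M) : TM :=
  (a (radius m), b (radius m) * m.2.2, -(b (radius m) * m.2.1))

/-- The flow of `rotField a b`. -/
noncomputable def rotFlow (a b : ℝ → ℝ) (t : ℝ) (m : M) : M :=
  (m.1 + ((a (radius m) * t : ℝ) : AddCircle (1 : ℝ)),
    Real.cos (b (radius m) * t) * m.2.1 + Real.sin (b (radius m) * t) * m.2.2,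
    Real.cos (b (radius m) * t) * m.2.2 - Real.sin (b (radius m) * t) * m.2.1)

lemma radius_polarLine {r : ℝ} (hr : 0 ≤ r) (θ₀ φ₀ a b t : ℝ) :
    radius (polarLine r θ₀ φ₀ a b t) = r :=
  polarLine_mem_level hr θ₀ φ₀ a b t

lemma rotFlow_polarLine (a b : ℝ → ℝ) {r : ℝ} (hr : 0 ≤ r) (θ₀ φ₀ s t : ℝ) :
    rotFlow a b t (polarLine r θ₀ φ₀ (a r) (-b r) s) =
      polarLine r θ₀ φ₀ (a r) (-b r) (s + t) := by
  rw [rotFlow, radius_polarLine hr]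
  have h : φ₀ + -b r * (s + t) = (φ₀ + -b r * s) - b r * t := by ring
  have h' : θ₀ + a r * (s + t) = (θ₀ + a r * s) + a r * t := by ring
  simp only [polarLine, h, h', Real.cos_sub, Real.sin_sub, AddCircle.coe_add, Prod.mk.injEq,
    true_and]
  constructor <;> ring

lemma isOrbit_polarLine (a b : ℝ → ℝ) {r : ℝ} (hr : 0 ≤ r) (θ₀ φ₀ : ℝ) :
    IsOrbit (rotField a b) (polarLine r θ₀ φ₀ (a r) (-b r)) := by
  intro t
  have := hasVelocityAt_polarLine r θ₀ φ₀ (a r) (-b r) t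
  simpa [rotField, radius_polarLine hr] using this

lemma isFlow_rotFlow (a b : ℝ → ℝ) : IsFlow (rotField a b) (rotFlow a b) := by
  intro m
  refine ⟨by simp [rotFlow], ?_⟩
  obtain ⟨θ₀, φ₀, hp⟩ := exists_polar_of_mem_level (r := radius m) (m := m) rfl
  have h : (fun t => rotFlow a b t m) =
      polarLine (radius m) θ₀ φ₀ (a (radius m)) (-b (radius m)) := by
    ext1 t
    have := rotFlow_polarLine a b (radius_nonneg m) θ₀ φ₀ 0 t
    rwa [hp, zero_add] at this
  rw [h]
  exact isOrbit_polarLine a b (radius_nonneg m) θ₀ φ₀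

lemma eq_of_hasDerivAt_zero {E : Type*} [NormedAddCommGroup E] [NormedSpace ℝ E] {c : ℝ → E}
    (h : ∀ t, HasDerivAt c 0 t) (t : ℝ) : c t = c 0 :=
  is_const_of_deriv_eq_zero (fun t => (h t).differentiableAt) (fun t => (h t).deriv) t 0

/-- Conservation of ρ freezes both coefficients along the orbit. Rotating back by the frozen angles
produces quantities with zero derivative, so no regularity of `a` or `b` and no general ODE
uniqueness theorem is needed. -/
lemma IsOrbit.eq_rotFlow {a b : ℝ → ℝ} {γ : ℝ → M} (h : IsOrbit (rotField a b) γ) (t : ℝ) :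
    γ t = rotFlow a b t (γ 0) := by
  have hx t := (h t).hasDerivAt_x
  have hy t := (h t).hasDerivAt_y
  have hθ t := (h t).hasDerivAt_toCircle
  simp only [rotField] at hx hy hθ
  have hρ t : radius (γ t) = radius (γ 0) := by
    rw [radius_eq_iff (radius_nonneg _), radius_sq]
    refine eq_of_hasDerivAt_zero (c := fun t => (γ t).2.1 ^ 2 + (γ t).2.2 ^ 2) (fun s => ?_) t
    refine (((hx s).pow 2).add ((hy s).pow 2)).congr_deriv ?_
    norm_num
    ring
  simp only [hρ] at hx hy hθ
  set α := a (radius (γ 0))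
  set β := b (radius (γ 0))
  have hl (k s : ℝ) : HasDerivAt (fun s => k * s) k s := by
    simpa using (hasDerivAt_id s).const_mul k
  have h1 := eq_of_hasDerivAt_zero
    (c := fun s => Real.cos (β * s) * (γ s).2.1 - Real.sin (β * s) * (γ s).2.2) (fun s => by
      refine (((hl β s).cos.mul (hx s)).sub ((hl β s).sin.mul (hy s))).congr_deriv ?_
      ring) t
  have h2 := eq_of_hasDerivAt_zero
    (c := fun s => Real.sin (β * s) * (γ s).2.1 + Real.cos (β * s) * (γ s).2.2) (fun s => by
      refine (((hl β s).sin.mul (hx s)).add ((hl β s).cos.mul (hy s))).congr_deriv ?_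
      ring) t
  have h3 := eq_of_hasDerivAt_zero
    (c := fun s => ((γ s).1.toCircle : ℂ) * Complex.exp (-(2 * Real.pi * (α * s : ℝ) * Complex.I)))
    (fun s => by
      have he := ((((hl α s).ofReal_comp.const_mul (2 * Real.pi : ℂ)).mul_const Complex.I).neg).cexp
      refine ((hθ s).mul he).congr_deriv ?_
      ring) t
  have hθt : (γ t).1 = (γ 0).1 + ((α * t : ℝ) : AddCircle (1 : ℝ)) := by
    apply AddCircle.injective_toCircle one_ne_zero
    apply Circle.ext
    simp only [mul_zero, Complex.ofReal_zero, zero_mul, neg_zero, Complex.exp_zero, mul_one] at h3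
    rw [AddCircle.toCircle_add, Circle.coe_mul, ← h3, AddCircle.toCircle_apply_mk, Circle.coe_exp,
      mul_assoc, ← Complex.exp_add]
    have : -(2 * Real.pi * ((α * t : ℝ) : ℂ) * Complex.I) +
        ((2 * Real.pi / 1 * (α * t) : ℝ) : ℂ) * Complex.I = 0 := by
      push_cast; ring
    rw [this, Complex.exp_zero, mul_one]
  simp only [mul_zero, Real.cos_zero, Real.sin_zero, zero_mul, one_mul, sub_zero, zero_add] at h1 h2
  have hcs := Real.sin_sq_add_cos_sq (β * t)
  refine Prod.ext hθt (Prod.ext ?_ ?_)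
  · change (γ t).2.1 = Real.cos (β * t) * (γ 0).2.1 + Real.sin (β * t) * (γ 0).2.2
    rw [← h1, ← h2]
    linear_combination -(γ t).2.1 * hcs
  · change (γ t).2.2 = Real.cos (β * t) * (γ 0).2.2 - Real.sin (β * t) * (γ 0).2.1
    rw [← h1, ← h2]
    linear_combination -(γ t).2.2 * hcs

lemma IsFlow.eq_rotFlow {a b : ℝ → ℝ} {φ : ℝ → M → M} (h : IsFlow (rotField a b) φ) :
    φ = rotFlow a b := by
  ext1 t
  ext1 m
  have := (h m).2.eq_rotFlow t
  rwa [(h m).1] at this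

/-! ### Linearization of the flow, off the axis and on it -/

/-- A lift of the time-`t` flow of `rotField a b` to tangent spaces. -/
noncomputable def rotFlowLift (a b : ℝ → ℝ) (t : ℝ) (m : M) (h : TM) : TM :=
  (h.1 + a (radius (m + expM h)) * t - a (radius m) * t,
    (Real.cos (b (radius (m + expM h)) * t) * (m.2.1 + h.2.1) +
      Real.sin (b (radius (m + expM h)) * t) * (m.2.2 + h.2.2)) -
    (Real.cos (b (radius m) * t) * m.2.1 + Real.sin (b (radius m) * t) * m.2.2),
    (Real.cos (b (radius (m + expM h)) * t) * (m.2.2 + h.2.2) -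
      Real.sin (b (radius (m + expM h)) * t) * (m.2.1 + h.2.1)) -
    (Real.cos (b (radius m) * t) * m.2.2 - Real.sin (b (radius m) * t) * m.2.1))

lemma hasDifferentialAt_rotFlow {a b : ℝ → ℝ} {t : ℝ} {m : M} {A : TM →L[ℝ] TM}
    (h : HasFDerivAt (rotFlowLift a b t m) A 0) : HasDifferentialAt (rotFlow a b t) A m := by
  refine ⟨rotFlowLift a b t m, by simp [rotFlowLift], h, Eventually.of_forall fun h => ?_⟩
  refine Prod.ext ?_ (Prod.ext ?_ ?_)
  · simp only [rotFlow, rotFlowLift, expM, Prod.fst_add, AddCircle.coe_add, AddCircle.coe_sub]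
    abel
  · simp only [rotFlow, rotFlowLift, expM, Prod.fst_add, Prod.snd_add]
    ring
  · simp only [rotFlow, rotFlowLift, expM, Prod.fst_add, Prod.snd_add]
    ring

lemma hasFDerivAt_radius {m : M} (hm : 0 < radius m) :
    HasFDerivAt (fun h : TM => radius (m + expM h))
      ((m.2.1 / radius m) •
        (ContinuousLinearMap.fst ℝ ℝ ℝ).comp (ContinuousLinearMap.snd ℝ ℝ (ℝ × ℝ)) +
      (m.2.2 / radius m) •
        (ContinuousLinearMap.snd ℝ ℝ ℝ).comp (ContinuousLinearMap.snd ℝ ℝ (ℝ × ℝ))) 0 := by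
  have hx := (((ContinuousLinearMap.fst ℝ ℝ ℝ).comp
    (ContinuousLinearMap.snd ℝ ℝ (ℝ × ℝ))).hasFDerivAt (x := 0)).const_add m.2.1
  have hy := (((ContinuousLinearMap.snd ℝ ℝ ℝ).comp
    (ContinuousLinearMap.snd ℝ ℝ (ℝ × ℝ))).hasFDerivAt (x := 0)).const_add m.2.2
  have hs : m.2.1 ^ 2 + m.2.2 ^ 2 ≠ 0 := by
    rw [← radius_sq]; positivity
  have := ((hx.pow 2).add (hy.pow 2)).sqrt (by simpa using hs)
  refine this.congr_fderiv ?_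
  ext <;> simp [radius] <;> field_simp

lemma exists_hasDifferentialAt_rotFlow {a b : ℝ → ℝ} {a' b' : ℝ} {m : M} (hm : 0 < radius m)
    (ha : HasDerivAt a a' (radius m)) (hb : HasDerivAt b b' (radius m)) (t : ℝ) :
    ∃ A : TM →L[ℝ] TM, HasDifferentialAt (rotFlow a b t) A m ∧
      ∀ v, A v =
        (v.1 + t * a' * ((m.2.1 * v.2.1 + m.2.2 * v.2.2) / radius m),
          Real.cos (b (radius m) * t) * v.2.1 + Real.sin (b (radius m) * t) * v.2.2 +
            t * b' * ((m.2.1 * v.2.1 + m.2.2 * v.2.2) / radius m) * (rotFlow a b t m).2.2,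
          Real.cos (b (radius m) * t) * v.2.2 - Real.sin (b (radius m) * t) * v.2.1 -
            t * b' * ((m.2.1 * v.2.1 + m.2.2 * v.2.2) / radius m) * (rotFlow a b t m).2.1) := by
  have hR := hasFDerivAt_radius hm
  have h0 : radius (m + expM 0) = radius m := by simp
  -- Puts the base point in the form the chain rule for `radius (m + expM h)` at `h = 0` expects.
  rw [← h0] at ha hb
  have h1 := (ContinuousLinearMap.fst ℝ ℝ (ℝ × ℝ)).hasFDerivAt (x := 0)
  have hx := (((ContinuousLinearMap.fst ℝ ℝ ℝ).comp
    (ContinuousLinearMap.snd ℝ ℝ (ℝ × ℝ))).hasFDerivAt (x := 0)).const_add m.2.1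
  have hy := (((ContinuousLinearMap.snd ℝ ℝ ℝ).comp
    (ContinuousLinearMap.snd ℝ ℝ (ℝ × ℝ))).hasFDerivAt (x := 0)).const_add m.2.2
  have hat := (ha.comp_hasFDerivAt 0 hR).mul_const t
  have hbt := (hb.comp_hasFDerivAt 0 hR).mul_const t
  have hc := hbt.cos
  have hs := hbt.sin
  have hF := ((h1.add hat).sub_const (a (radius m) * t)).prodMk
    ((((hc.mul hx).add (hs.mul hy)).sub_const
      (Real.cos (b (radius m) * t) * m.2.1 + Real.sin (b (radius m) * t) * m.2.2)).prodMk
    (((hc.mul hy).sub (hs.mul hx)).sub_const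
      (Real.cos (b (radius m) * t) * m.2.2 - Real.sin (b (radius m) * t) * m.2.1)))
  refine ⟨_, hasDifferentialAt_rotFlow hF, fun v => ?_⟩
  refine Prod.ext ?_ (Prod.ext ?_ ?_)
  · simp
    ring
  · simp [rotFlow]
    ring
  · simp [rotFlow]
    ring

/-- The discrepancy (c(y) - c(x)) l(y) is o(1) · O(y - x), so continuity of `c` suffices. On the
axis this covers cos(bt) · x and its companions using only continuity of `b`. -/
lemma hasFDerivAt_mul_of_eq_zero {E : Type*} [NormedAddCommGroup E] [NormedSpace ℝ E]
    {c l : E → ℝ} {L : E →L[ℝ] ℝ} {x : E} (hc : ContinuousAt c x) (hl : HasFDerivAt l L x)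
    (h0 : l x = 0) : HasFDerivAt (fun y => c y * l y) (c x • L) x := by
  have h1 : (fun y => (c y - c x) * l y) =o[𝓝 x] fun y => y - x := by
    have h2 : (fun y => c y - c x) =o[𝓝 x] fun _ => (1 : ℝ) := by
      rw [Asymptotics.isLittleO_one_iff]
      simpa using hc.sub_const (c x)
    have h3 : l =O[𝓝 x] fun y => y - x := by
      simpa [h0] using hl.isBigO_sub
    simpa using h2.mul_isBigO h3.norm_right
  have h4 : HasFDerivAt (fun y => (c y - c x) * l y) (0 : E →L[ℝ] ℝ) x := by
    rw [hasFDerivAt_iff_isLittleO]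
    simpa [h0] using h1
  refine ((h4.add (hl.const_mul (c x))).congr_fderiv (zero_add _)).congr_of_eventuallyEq ?_
  refine Eventually.of_forall fun y => ?_
  simp only [Pi.add_apply]
  ring

lemma radius_add_expM_center {m : M} (hm : radius m = 0) (h : TM) :
    radius (m + expM h) = √(h.2.1 ^ 2 + h.2.2 ^ 2) := by
  have := radius_eq_zero_iff.1 hm
  simp [radius, expM, this]

lemma continuous_radius_add_expM (m : M) : Continuous fun h : TM => radius (m + expM h) := by
  simp only [radius, expM, Prod.snd_add, Prod.fst_add]
  fun_prop

/-- The radius is not differentiable on the axis, but it is O(‖h‖), and `a` varies by o(ρ). -/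
lemma hasFDerivAt_comp_radius_center {a : ℝ → ℝ} {m : M} (hm : radius m = 0)
    (ha : HasDerivAt a 0 0) :
    HasFDerivAt (fun h : TM => a (radius (m + expM h))) (0 : TM →L[ℝ] ℝ) 0 := by
  have hRO : (fun h : TM => radius (m + expM h)) =O[𝓝 0] fun h => h := by
    refine Asymptotics.IsBigO.of_bound 2 (Eventually.of_forall fun h => ?_)
    rw [radius_add_expM_center hm, Real.norm_of_nonneg (Real.sqrt_nonneg _)]
    have h1 : |h.2.1| ≤ ‖h‖ := (norm_fst_le h.2).trans (norm_snd_le h)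
    have h2 : |h.2.2| ≤ ‖h‖ := (norm_snd_le h.2).trans (norm_snd_le h)
    apply Real.sqrt_le_iff.2
    refine ⟨by positivity, ?_⟩
    nlinarith [sq_abs h.2.1, sq_abs h.2.2, abs_nonneg h.2.1, abs_nonneg h.2.2,
      pow_le_pow_left₀ (abs_nonneg h.2.1) h1 2, pow_le_pow_left₀ (abs_nonneg h.2.2) h2 2]
  rw [hasDerivAt_iff_isLittleO] at ha
  have hT : Tendsto (fun h : TM => radius (m + expM h)) (𝓝 0) (𝓝 0) := by
    simpa [hm] using (continuous_radius_add_expM m).tendsto 0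
  rw [hasFDerivAt_iff_isLittleO]
  have := (ha.comp_tendsto hT)
  simp only [Function.comp_def, sub_zero, smul_zero] at this
  simpa [hm] using this.trans_isBigO hRO

lemma exists_hasDifferentialAt_rotFlow_center {a b : ℝ → ℝ} {m : M} (hm : radius m = 0)
    (ha : HasDerivAt a 0 0) (hb : ContinuousAt b 0) (t : ℝ) :
    ∃ A : TM →L[ℝ] TM, HasDifferentialAt (rotFlow a b t) A m ∧
      ∀ v, A v = (v.1, Real.cos (b 0 * t) * v.2.1 + Real.sin (b 0 * t) * v.2.2,
        Real.cos (b 0 * t) * v.2.2 - Real.sin (b 0 * t) * v.2.1) := by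
  have hR0 : radius (m + expM 0) = 0 := by simpa using hm
  have hm2 := radius_eq_zero_iff.1 hm
  have hRc : ContinuousAt (fun h : TM => radius (m + expM h)) 0 :=
    (continuous_radius_add_expM m).continuousAt
  have haR := hasFDerivAt_comp_radius_center hm ha
  have hbR : ContinuousAt (fun h : TM => b (radius (m + expM h)) * t) 0 := by
    refine ContinuousAt.mul ?_ continuousAt_const
    exact ContinuousAt.comp_of_eq hb hRc hR0
  have hc : ContinuousAt (fun h : TM => Real.cos (b (radius (m + expM h)) * t)) 0 :=
    Real.continuous_cos.continuousAt.comp hbR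
  have hs : ContinuousAt (fun h : TM => Real.sin (b (radius (m + expM h)) * t)) 0 :=
    Real.continuous_sin.continuousAt.comp hbR
  have h1 := (ContinuousLinearMap.fst ℝ ℝ (ℝ × ℝ)).hasFDerivAt (x := 0)
  have hx := (((ContinuousLinearMap.fst ℝ ℝ ℝ).comp
    (ContinuousLinearMap.snd ℝ ℝ (ℝ × ℝ))).hasFDerivAt (x := 0)).const_add m.2.1
  have hy := (((ContinuousLinearMap.snd ℝ ℝ ℝ).comp
    (ContinuousLinearMap.snd ℝ ℝ (ℝ × ℝ))).hasFDerivAt (x := 0)).const_add m.2.2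
  have hx0 : m.2.1 + ((ContinuousLinearMap.fst ℝ ℝ ℝ).comp
    (ContinuousLinearMap.snd ℝ ℝ (ℝ × ℝ))) (0 : TM) = 0 := by simp [hm2]
  have hy0 : m.2.2 + ((ContinuousLinearMap.snd ℝ ℝ ℝ).comp
    (ContinuousLinearMap.snd ℝ ℝ (ℝ × ℝ))) (0 : TM) = 0 := by simp [hm2]
  have hF := ((h1.add (haR.mul_const t)).sub_const (a (radius m) * t)).prodMk
    ((((hasFDerivAt_mul_of_eq_zero hc hx hx0).add
      (hasFDerivAt_mul_of_eq_zero hs hy hy0)).sub_const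
      (Real.cos (b (radius m) * t) * m.2.1 + Real.sin (b (radius m) * t) * m.2.2)).prodMk
    (((hasFDerivAt_mul_of_eq_zero hc hy hy0).sub
      (hasFDerivAt_mul_of_eq_zero hs hx hx0)).sub_const
      (Real.cos (b (radius m) * t) * m.2.2 - Real.sin (b (radius m) * t) * m.2.1)))
  refine ⟨_, hasDifferentialAt_rotFlow hF, fun v => ?_⟩
  refine Prod.ext ?_ (Prod.ext ?_ ?_)
  · simp
  · simp [hm]
  · simp [hm]

end SymOrbits

namespace SymOrbits

/-! ### Even functions and their derivatives divided by the variable -/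

/-- The even function on `ℝ` with the same values as `u` on `[0, ∞)`. -/
def evenExt (u : ℝ → ℝ) (x : ℝ) : ℝ := u |x|

lemma evenExt_of_nonneg (u : ℝ → ℝ) {x : ℝ} (hx : 0 ≤ x) : evenExt u x = u x := by
  rw [evenExt, abs_of_nonneg hx]

lemma evenExt_neg (u : ℝ → ℝ) (x : ℝ) : evenExt u (-x) = evenExt u x := by
  rw [evenExt, abs_neg, evenExt]

/-- Restrict to the line y = 0, where ρ = |x|. -/
lemma RadiallySmooth.contDiff_evenExt {u : ℝ → ℝ} (hu : RadiallySmooth u) :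
    ContDiff ℝ ∞ (evenExt u) := by
  have h : ContDiff ℝ ∞ fun x : ℝ => ((x, 0) : ℝ × ℝ) := by fun_prop
  have := hu.comp h
  convert this using 1
  ext x
  simp [evenExt, Real.sqrt_sq_eq_abs]

lemma evenExt_eventuallyEq (u : ℝ → ℝ) {x : ℝ} (hx : 0 < x) : evenExt u =ᶠ[𝓝 x] u := by
  filter_upwards [lt_mem_nhds hx] with y hy
  exact evenExt_of_nonneg u hy.le

lemma deriv_zero_of_even {u : ℝ → ℝ} (he : ∀ x, u (-x) = u x) : deriv u 0 = 0 := by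
  have h := deriv_comp_neg u 0
  simp only [he, neg_zero] at h
  linarith

lemma deriv_odd_of_even {u : ℝ → ℝ} (he : ∀ x, u (-x) = u x) (x : ℝ) :
    deriv u (-x) = -deriv u x := by
  have h := deriv_comp_neg u x
  simp only [he] at h
  linarith

lemma deriv_even_of_odd {u : ℝ → ℝ} (ho : ∀ x, u (-x) = -u x) (x : ℝ) :
    deriv u (-x) = deriv u x := by
  have h := deriv_comp_neg u x
  simp only [ho, deriv.fun_neg] at h
  linarith

/-- `u'(x) / x`, extended by `u''(0)` at `0`. -/
noncomputable def radialDeriv (u : ℝ → ℝ) : ℝ → ℝ := dslope (deriv u) 0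

lemma radialDeriv_zero (u : ℝ → ℝ) : radialDeriv u 0 = deriv (deriv u) 0 := dslope_same _ _

lemma radialDeriv_of_ne {u : ℝ → ℝ} (h0 : deriv u 0 = 0) {x : ℝ} (hx : x ≠ 0) :
    radialDeriv u x = deriv u x / x := by
  rw [radialDeriv, dslope_of_ne _ hx, slope_def_field, h0, sub_zero, sub_zero]

lemma differentiableAt_radialDeriv {u : ℝ → ℝ} (hu : ContDiff ℝ ∞ u) {x : ℝ} (hx : x ≠ 0) :
    DifferentiableAt ℝ (radialDeriv u) x :=
  (differentiableAt_dslope_of_ne hx).2 (contDiff_infty_iff_deriv.1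
    (contDiff_infty_iff_deriv.1 hu).2).1.differentiableAt

/-- Since u' is odd, u'(x)/x is even. In Taylor terms its linear coefficient at 0 is u'''(0)/2,
which vanishes because u'' is even. -/
lemma hasDerivAt_radialDeriv_zero {u : ℝ → ℝ} (hu : ContDiff ℝ ∞ u) (he : ∀ x, u (-x) = u x) :
    HasDerivAt (radialDeriv u) 0 0 := by
  have h0 := deriv_zero_of_even he
  have hu1 := (contDiff_infty_iff_deriv.1 hu).2
  have hu2 := (contDiff_infty_iff_deriv.1 hu1).2
  have d1 := (contDiff_infty_iff_deriv.1 hu1).1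
  have d2 := (contDiff_infty_iff_deriv.1 hu2).1
  set p := deriv u with hp
  have h3 : deriv (deriv p) 0 = 0 := deriv_zero_of_even (deriv_even_of_odd (deriv_odd_of_even he))
  rw [hasDerivAt_iff_tendsto_slope]
  -- This quotient is the slope of p(x)/x at 0; L'Hôpital turns it into half the slope of p' at 0.
  have hl : Tendsto (fun x => (p x - deriv p 0 * x) / x ^ 2) (𝓝[≠] 0) (𝓝 0) := by
    refine HasDerivAt.lhopital_zero_nhdsNE (f' := fun x => deriv p x - deriv p 0)
      (g' := fun x => 2 * x) (Eventually.of_forall fun x => ?_) (Eventually.of_forall fun x => ?_)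
      ?_ ?_ ?_ ?_
    · have := (d1 x).hasDerivAt.sub ((hasDerivAt_id x).const_mul (deriv p 0))
      exact this.congr_deriv (by simp)
    · simpa using hasDerivAt_pow 2 x
    · filter_upwards [self_mem_nhdsWithin] with x hx
      exact mul_ne_zero two_ne_zero hx
    · have : ContinuousAt (fun x => p x - deriv p 0 * x) 0 :=
        (d1 0).continuousAt.sub (continuousAt_const.mul continuousAt_id)
      have := this.tendsto.mono_left (nhdsWithin_le_nhds (s := {0}ᶜ))
      simpa [h0] using this
    · have : ContinuousAt (fun x : ℝ => x ^ 2) 0 := by fun_prop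
      have := this.tendsto.mono_left (nhdsWithin_le_nhds (s := {0}ᶜ))
      simpa using this
    · have := (hasDerivAt_iff_tendsto_slope.1 (d2 0).hasDerivAt).div_const 2
      rw [h3, zero_div] at this
      refine this.congr' ?_
      filter_upwards [self_mem_nhdsWithin] with x hx
      rw [slope_def_field, sub_zero, div_div, mul_comm]
  refine hl.congr' ?_
  filter_upwards [self_mem_nhdsWithin] with x hx
  have hx' : x ≠ 0 := hx
  rw [slope_def_field, radialDeriv_of_ne h0 hx', radialDeriv_zero, ← hp]
  field_simp
  ring

lemma secondDerivZero_eq {u : ℝ → ℝ} (hu : ContDiff ℝ ∞ (evenExt u)) :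
    secondDerivZero u = radialDeriv (evenExt u) 0 := by
  have h : EqOn u (evenExt u) (Ici 0) := fun x hx => (evenExt_of_nonneg u hx).symm
  rw [secondDerivZero, iteratedDerivWithin_congr h self_mem_Ici,
    iteratedDerivWithin_eq_iteratedDeriv (uniqueDiffOn_Ici 0)
      (contDiff_infty.1 hu 2).contDiffAt self_mem_Ici, radialDeriv_zero]
  simp [iteratedDeriv_succ]

/-- Since ρ dρ = x dx + y dy, the differential is (u'/ρ)(x dx + y dy), which remains regular, and
vanishes, on the axis. -/
lemma hasFDerivAt_comp_radius {u : ℝ → ℝ} (hu : Differentiable ℝ u) (h0 : deriv u 0 = 0) (m : M) :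
    HasFDerivAt (fun h : TM => u (radius (m + expM h)))
      (radialDeriv u (radius m) • (m.2.1 •
        (ContinuousLinearMap.fst ℝ ℝ ℝ).comp (ContinuousLinearMap.snd ℝ ℝ (ℝ × ℝ)) +
      m.2.2 •
        (ContinuousLinearMap.snd ℝ ℝ ℝ).comp (ContinuousLinearMap.snd ℝ ℝ (ℝ × ℝ)))) 0 := by
  rcases (radius_nonneg m).eq_or_lt with hm | hm
  · refine (hasFDerivAt_comp_radius_center hm.symm ((hu 0).hasDerivAt.congr_deriv h0)).congr_fderiv ?_
    simp [radius_eq_zero_iff.1 hm.symm]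
  · have h := (hu (radius m)).hasDerivAt
    rw [show radius m = radius (m + expM 0) by simp] at h
    refine (h.comp_hasFDerivAt 0 (hasFDerivAt_radius hm)).congr_fderiv ?_
    rw [radialDeriv_of_ne h0 hm.ne']
    ext <;> simp <;> field_simp

/-! ### The coefficients of the Reeb vector field -/

variable {f g : ℝ → ℝ}

/-- The Wronskian of `f, g` divided by `ρ`, extended smoothly by `f(0) g''(0)`. -/
noncomputable def radialWronskian (f g : ℝ → ℝ) (ρ : ℝ) : ℝ :=
  evenExt f ρ * radialDeriv (evenExt g) ρ - radialDeriv (evenExt f) ρ * evenExt g ρ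

/-- The `∂_θ`-component of the Reeb vector field. -/
noncomputable def reebA (f g : ℝ → ℝ) (ρ : ℝ) : ℝ :=
  radialDeriv (evenExt g) ρ / radialWronskian f g ρ

/-- Minus the `∂_φ`-component of the Reeb vector field. -/
noncomputable def reebB (f g : ℝ → ℝ) (ρ : ℝ) : ℝ :=
  radialDeriv (evenExt f) ρ / radialWronskian f g ρ

namespace IsContactData

lemma exists_evenExt_g (h : IsContactData f g) :
    ∃ w : ℝ → ℝ, RadiallySmooth w ∧ evenExt g = fun x => x ^ 2 * evenExt w x := by
  obtain ⟨w, hw, hg⟩ := h.smooth_g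
  refine ⟨w, hw, ?_⟩
  ext x
  rw [evenExt, hg _ (abs_nonneg x), sq_abs, evenExt]

lemma contDiff_f (h : IsContactData f g) : ContDiff ℝ ∞ (evenExt f) := h.smooth_f.contDiff_evenExt

lemma contDiff_g (h : IsContactData f g) : ContDiff ℝ ∞ (evenExt g) := by
  obtain ⟨w, hw, hg⟩ := h.exists_evenExt_g
  rw [hg]
  have := hw.contDiff_evenExt
  fun_prop

lemma g_zero (h : IsContactData f g) : g 0 = 0 := by
  obtain ⟨w, -, hg⟩ := h.smooth_g
  simpa using hg 0 le_rfl

lemma radialDeriv_f (_ : IsContactData f g) {ρ : ℝ} (hρ : 0 < ρ) :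
    radialDeriv (evenExt f) ρ = deriv f ρ / ρ := by
  rw [radialDeriv_of_ne (deriv_zero_of_even (evenExt_neg f)) hρ.ne',
    (evenExt_eventuallyEq f hρ).deriv_eq]

lemma radialDeriv_g (_ : IsContactData f g) {ρ : ℝ} (hρ : 0 < ρ) :
    radialDeriv (evenExt g) ρ = deriv g ρ / ρ := by
  rw [radialDeriv_of_ne (deriv_zero_of_even (evenExt_neg g)) hρ.ne',
    (evenExt_eventuallyEq g hρ).deriv_eq]

lemma radialWronskian_eq (h : IsContactData f g) {ρ : ℝ} (hρ : 0 < ρ) :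
    radialWronskian f g ρ = wronskian f g ρ / ρ := by
  rw [radialWronskian, h.radialDeriv_f hρ, h.radialDeriv_g hρ, evenExt_of_nonneg f hρ.le,
    evenExt_of_nonneg g hρ.le, wronskian]
  ring

lemma radialWronskian_zero (h : IsContactData f g) :
    radialWronskian f g 0 = f 0 * secondDerivZero g := by
  rw [radialWronskian, secondDerivZero_eq h.contDiff_g, evenExt_of_nonneg f le_rfl,
    evenExt_of_nonneg g le_rfl, h.g_zero]
  ring

lemma radialWronskian_pos (h : IsContactData f g) {ρ : ℝ} (hρ : 0 ≤ ρ) :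
    0 < radialWronskian f g ρ := by
  rcases hρ.eq_or_lt with rfl | hρ
  · rw [h.radialWronskian_zero]
    exact h.center_pos
  · rw [h.radialWronskian_eq hρ]
    exact div_pos (h.wronskian_pos ρ hρ) hρ

lemma reebA_eq (h : IsContactData f g) {ρ : ℝ} (hρ : 0 < ρ) :
    reebA f g ρ = deriv g ρ / wronskian f g ρ := by
  rw [reebA, h.radialWronskian_eq hρ, h.radialDeriv_g hρ, div_div_div_cancel_right₀ hρ.ne']

lemma reebB_eq (h : IsContactData f g) {ρ : ℝ} (hρ : 0 < ρ) :
    reebB f g ρ = deriv f ρ / wronskian f g ρ := by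
  rw [reebB, h.radialWronskian_eq hρ, h.radialDeriv_f hρ, div_div_div_cancel_right₀ hρ.ne']

lemma f_zero_ne (h : IsContactData f g) : f 0 ≠ 0 := left_ne_zero_of_mul h.center_pos.ne'

lemma secondDerivZero_g_ne (h : IsContactData f g) : secondDerivZero g ≠ 0 :=
  right_ne_zero_of_mul h.center_pos.ne'

lemma reebA_zero (h : IsContactData f g) : reebA f g 0 = 1 / f 0 := by
  have h1 := h.f_zero_ne
  have h2 := h.secondDerivZero_g_ne
  rw [reebA, h.radialWronskian_zero, ← secondDerivZero_eq h.contDiff_g]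
  field_simp

lemma reebB_zero (h : IsContactData f g) :
    reebB f g 0 = secondDerivZero f / (f 0 * secondDerivZero g) := by
  rw [reebB, h.radialWronskian_zero, ← secondDerivZero_eq h.contDiff_f]

lemma hasDerivAt_radialWronskian_zero (h : IsContactData f g) :
    HasDerivAt (radialWronskian f g) 0 0 := by
  have hf := ((contDiff_infty_iff_deriv.1 h.contDiff_f).1 0).hasDerivAt
  have hg := ((contDiff_infty_iff_deriv.1 h.contDiff_g).1 0).hasDerivAt
  rw [deriv_zero_of_even (evenExt_neg _)] at hf hg
  have := (hf.mul (hasDerivAt_radialDeriv_zero h.contDiff_g (evenExt_neg g))).sub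
    ((hasDerivAt_radialDeriv_zero h.contDiff_f (evenExt_neg f)).mul hg)
  exact this.congr_deriv (by simp)

lemma hasDerivAt_reebA_zero (h : IsContactData f g) : HasDerivAt (reebA f g) 0 0 := by
  have := (hasDerivAt_radialDeriv_zero h.contDiff_g (evenExt_neg g)).div
    h.hasDerivAt_radialWronskian_zero (h.radialWronskian_pos le_rfl).ne'
  exact this.congr_deriv (by simp)

lemma continuousAt_reebB_zero (h : IsContactData f g) : ContinuousAt (reebB f g) 0 :=
  (hasDerivAt_radialDeriv_zero h.contDiff_f (evenExt_neg f)).continuousAt.div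
    h.hasDerivAt_radialWronskian_zero.continuousAt (h.radialWronskian_pos le_rfl).ne'

lemma differentiableAt_radialWronskian (h : IsContactData f g) {ρ : ℝ} (hρ : 0 < ρ) :
    DifferentiableAt ℝ (radialWronskian f g) ρ :=
  (((contDiff_infty_iff_deriv.1 h.contDiff_f).1 ρ).mul
    (differentiableAt_radialDeriv h.contDiff_g hρ.ne')).sub
  ((differentiableAt_radialDeriv h.contDiff_f hρ.ne').mul
    ((contDiff_infty_iff_deriv.1 h.contDiff_g).1 ρ))

lemma differentiableAt_reebA (h : IsContactData f g) {ρ : ℝ} (hρ : 0 < ρ) :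
    DifferentiableAt ℝ (reebA f g) ρ :=
  (differentiableAt_radialDeriv h.contDiff_g hρ.ne').div (h.differentiableAt_radialWronskian hρ)
    (h.radialWronskian_pos hρ.le).ne'

lemma differentiableAt_reebB (h : IsContactData f g) {ρ : ℝ} (hρ : 0 < ρ) :
    DifferentiableAt ℝ (reebB f g) ρ :=
  (differentiableAt_radialDeriv h.contDiff_f hρ.ne').div (h.differentiableAt_radialWronskian hρ)
    (h.radialWronskian_pos hρ.le).ne'

lemma differentiableAt_f (h : IsContactData f g) {ρ : ℝ} (hρ : 0 < ρ) : DifferentiableAt ℝ f ρ :=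
  ((contDiff_infty_iff_deriv.1 h.contDiff_f).1 ρ).congr_of_eventuallyEq
    (evenExt_eventuallyEq f hρ).symm

lemma differentiableAt_g (h : IsContactData f g) {ρ : ℝ} (hρ : 0 < ρ) : DifferentiableAt ℝ g ρ :=
  ((contDiff_infty_iff_deriv.1 h.contDiff_g).1 ρ).congr_of_eventuallyEq
    (evenExt_eventuallyEq g hρ).symm

/-! ### The Reeb vector field -/

/-- Replaces g/ρ² by its smooth extension `w`. On the axis the value of the quotient is immaterial,
as x dy - y dx vanishes there. -/
lemma symForm_eq {w : ℝ → ℝ} (hw : evenExt g = fun x => x ^ 2 * evenExt w x) (m : M) :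
    symForm f g m = evenExt f (radius m) • ContinuousLinearMap.fst ℝ ℝ (ℝ × ℝ) +
    evenExt w (radius m) •
      (m.2.1 • (ContinuousLinearMap.snd ℝ ℝ ℝ).comp (ContinuousLinearMap.snd ℝ ℝ (ℝ × ℝ)) -
        m.2.2 • (ContinuousLinearMap.fst ℝ ℝ ℝ).comp (ContinuousLinearMap.snd ℝ ℝ (ℝ × ℝ))) := by
  rw [symForm, evenExt_of_nonneg f (radius_nonneg m)]
  congr 1
  by_cases hm : radius m = 0
  · simp [radius_eq_zero_iff.1 hm]
  · rw [← evenExt_of_nonneg g (radius_nonneg m), hw, mul_div_cancel_left₀ _ (pow_ne_zero 2 hm)]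

lemma radialDeriv_g_eq {w : ℝ → ℝ} (hs : RadiallySmooth w)
    (hw : evenExt g = fun x => x ^ 2 * evenExt w x) (ρ : ℝ) :
    radialDeriv (evenExt g) ρ = 2 * evenExt w ρ + ρ ^ 2 * radialDeriv (evenExt w) ρ := by
  have hws := contDiff_infty_iff_deriv.1 hs.contDiff_evenExt
  have hd : deriv (evenExt g) = fun x => 2 * x * evenExt w x + x ^ 2 * deriv (evenExt w) x := by
    ext x
    rw [hw]
    exact (((hasDerivAt_pow 2 x).mul (hws.1 x).hasDerivAt).congr_deriv (by simp)).deriv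
  by_cases hρ : ρ = 0
  · subst hρ
    rw [radialDeriv_zero, hd]
    have := ((((hasDerivAt_id (0 : ℝ)).const_mul 2).mul (hws.1 0).hasDerivAt).add
      ((hasDerivAt_pow 2 (0 : ℝ)).mul ((contDiff_infty_iff_deriv.1 hws.2).1 0).hasDerivAt))
    exact (this.congr_deriv (by simp)).deriv
  · rw [radialDeriv_of_ne (deriv_zero_of_even (evenExt_neg g)) hρ,
      radialDeriv_of_ne (deriv_zero_of_even (evenExt_neg w)) hρ, hd]
    field_simp

/-- This is dλ = (f'/ρ)(x dx + y dy) ∧ dθ + (g'/ρ) dx ∧ dy; the last coefficient arises as 2w + ρw'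
with g = ρ²w. -/
lemma dForm_symForm (h : IsContactData f g) (m : M) (p v : TM) :
    dForm (symForm f g) m p v =
      radialDeriv (evenExt f) (radius m) *
        ((m.2.1 * p.2.1 + m.2.2 * p.2.2) * v.1 - (m.2.1 * v.2.1 + m.2.2 * v.2.2) * p.1) +
      radialDeriv (evenExt g) (radius m) * (p.2.1 * v.2.2 - p.2.2 * v.2.1) := by
  obtain ⟨w, hs, hw⟩ := h.exists_evenExt_g
  have hf := hasFDerivAt_comp_radius (contDiff_infty_iff_deriv.1 h.contDiff_f).1
    (deriv_zero_of_even (evenExt_neg f)) m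
  have hh := hasFDerivAt_comp_radius (contDiff_infty_iff_deriv.1 hs.contDiff_evenExt).1
    (deriv_zero_of_even (evenExt_neg w)) m
  have hx := (((ContinuousLinearMap.fst ℝ ℝ ℝ).comp
    (ContinuousLinearMap.snd ℝ ℝ (ℝ × ℝ))).hasFDerivAt (x := 0)).const_add m.2.1
  have hy := (((ContinuousLinearMap.snd ℝ ℝ ℝ).comp
    (ContinuousLinearMap.snd ℝ ℝ (ℝ × ℝ))).hasFDerivAt (x := 0)).const_add m.2.2
  have hF := (hf.smul_const (ContinuousLinearMap.fst ℝ ℝ (ℝ × ℝ))).add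
    (hh.smul ((hx.smul_const
      ((ContinuousLinearMap.snd ℝ ℝ ℝ).comp (ContinuousLinearMap.snd ℝ ℝ (ℝ × ℝ)))).sub
      (hy.smul_const
        ((ContinuousLinearMap.fst ℝ ℝ ℝ).comp (ContinuousLinearMap.snd ℝ ℝ (ℝ × ℝ))))))
  have he : (fun k : TM => symForm f g (m + expM k)) = _ := funext fun k => symForm_eq hw (m + expM k)
  rw [dForm, he]
  erw [hF.fderiv]
  rw [radialDeriv_g_eq hs hw, radius_sq]
  simp
  ring

lemma isReebField_iff (h : IsContactData f g) {X : M → TM} :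
    IsReebField (symForm f g) X ↔ X = rotField (reebA f g) (reebB f g) := by
  obtain ⟨w, hs, hw⟩ := h.exists_evenExt_g
  have hD m : radialWronskian f g (radius m) ≠ 0 := (h.radialWronskian_pos (radius_nonneg m)).ne'
  have hDd m : radialWronskian f g (radius m) =
      evenExt f (radius m) * radialDeriv (evenExt g) (radius m) -
        radialDeriv (evenExt f) (radius m) *
          ((m.2.1 ^ 2 + m.2.2 ^ 2) * evenExt w (radius m)) := by
    rw [radialWronskian, ← radius_sq, congrFun hw (radius m)]
  constructor
  · intro hX
    ext1 m
    obtain ⟨h1, h2⟩ := hX m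
    have e1 := h2 (1, 0, 0)
    have e2 := h2 (0, 1, 0)
    have e3 := h2 (0, 0, 1)
    rw [h.dForm_symForm] at e1 e2 e3
    rw [symForm_eq hw] at h1
    have hDm := hD m
    have hDdm := hDd m
    simp at h1 e1 e2 e3
    set D := radialWronskian f g (radius m)
    set F := radialDeriv (evenExt f) (radius m)
    set G := radialDeriv (evenExt g) (radius m)
    set u := evenExt f (radius m)
    set k := evenExt w (radius m)
    have e1' : F * (m.2.1 * (X m).2.1 + m.2.2 * (X m).2.2) = 0 := by
      rcases e1 with e | e <;> simp [e]
    -- Cramer's rule with determinant `D`, the Wronskian over ρ; no division by ρ occurs, so the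
    -- axis needs no separate case.
    refine Prod.ext ?_ (Prod.ext ?_ ?_)
    · change _ = G / D
      rw [eq_div_iff hDm]
      linear_combination (X m).1 * hDdm + G * h1 + k * m.2.1 * e2 + k * m.2.2 * e3
    · change _ = F / D * m.2.2
      rw [div_mul_eq_mul_div, eq_div_iff hDm]
      linear_combination (X m).2.1 * hDdm + F * m.2.2 * h1 + u * e3 - k * m.2.1 * e1'
    · change _ = -(F / D * m.2.1)
      rw [div_mul_eq_mul_div, ← neg_div, eq_div_iff hDm]
      linear_combination (X m).2.2 * hDdm - F * m.2.1 * h1 - u * e2 - k * m.2.2 * e1'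
  · rintro rfl m
    have hDm := hD m
    have hDdm := hDd m
    refine ⟨?_, fun v => ?_⟩
    · rw [symForm_eq hw]
      simp only [rotField, reebA, reebB]
      simp
      field_simp
      linear_combination -hDdm
    · rw [h.dForm_symForm]
      simp only [rotField, reebA, reebB]
      field_simp
      ring

end IsContactData

end SymOrbits

namespace SymOrbits

/-! ### Periods of lines in polar coordinates -/

lemma polarLine_periodic {r θ₀ φ₀ a b S : ℝ} {n l : ℤ} (ha : a * S = n)
    (hb : b * S = l * (2 * Real.pi)) : Function.Periodic (polarLine r θ₀ φ₀ a b) S := by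
  intro t
  have h1 : φ₀ + b * (t + S) = (φ₀ + b * t) + l * (2 * Real.pi) := by rw [← hb]; ring
  have h2 : θ₀ + a * (t + S) = (θ₀ + a * t) + n := by rw [← ha]; ring
  have h3 : ((n : ℝ) : AddCircle (1 : ℝ)) = 0 :=
    (AddCircle.coe_eq_zero_iff 1).2 ⟨n, by simp⟩
  rw [polarLine, polarLine, h1, h2, AddCircle.coe_add, h3, add_zero, Real.cos_add_int_mul_two_pi,
    Real.sin_add_int_mul_two_pi]

lemma exists_int_of_coe_add_eq {x y : ℝ} (h : ((x + y : ℝ) : AddCircle (1 : ℝ)) = x) :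
    ∃ n : ℤ, y = n := by
  rw [AddCircle.coe_add, add_eq_left] at h
  obtain ⟨n, hn⟩ := (AddCircle.coe_eq_zero_iff 1).1 h
  exact ⟨n, by simpa using hn.symm⟩

lemma exists_int_of_polarLine_periodic {r θ₀ φ₀ a b S : ℝ} (hr : 0 < r)
    (h : Function.Periodic (polarLine r θ₀ φ₀ a b) S) :
    ∃ n l : ℤ, a * S = n ∧ b * S = l * (2 * Real.pi) := by
  have h0 := h 0
  simp only [polarLine, zero_add, mul_zero, add_zero, Prod.mk.injEq, mul_eq_mul_left_iff, hr.ne',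
    or_false] at h0
  obtain ⟨h1, h2, h3⟩ := h0
  obtain ⟨n, hn⟩ := exists_int_of_coe_add_eq h1
  have h4 : Real.cos (b * S) = 1 := by
    rw [show b * S = (φ₀ + b * S) - φ₀ by ring, Real.cos_sub, h2, h3]
    nlinarith [Real.sin_sq_add_cos_sq φ₀]
  obtain ⟨l, hl⟩ := (Real.cos_eq_one_iff _).1 h4
  exact ⟨n, l, hn, hl.symm⟩

lemma isMinimalPeriod_polarLine {r T : ℝ} (hr : 0 < r) (hT : 0 < T) {p q : ℤ} (hpq : IsCoprime p q)
    (θ₀ φ₀ : ℝ) :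
    IsMinimalPeriod (polarLine r θ₀ φ₀ (q / T) (-(2 * Real.pi * p / T))) T := by
  refine ⟨hT, polarLine_periodic (n := q) (l := -p) (by field_simp) (by push_cast; field_simp),
    fun S hS hp => ?_⟩
  obtain ⟨n, l, h1, h2⟩ := exists_int_of_polarLine_periodic hr hp
  -- A period S makes both qS/T and pS/T integers; Bezout's identity makes S/T itself an integer,
  -- and it is positive.
  obtain ⟨u, v, huv⟩ := hpq
  have huv' : (u * p + v * q : ℝ) = 1 := by exact_mod_cast huv
  have hpi := Real.pi_ne_zero
  have h3 : p * S / T = -l := by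
    field_simp at h2 ⊢
    linarith
  have h4 : S / T = ((v * n - u * l : ℤ) : ℝ) := by
    push_cast
    rw [← h1, ← neg_neg (l : ℝ), ← h3]
    field_simp
    linear_combination -huv'
  have h5 : 0 < S / T := by positivity
  rw [h4] at h5
  have h6 : (1 : ℝ) ≤ ((v * n - u * l : ℤ) : ℝ) := by exact_mod_cast h5
  rwa [← h4, le_div_iff₀ hT, one_mul] at h6

lemma iUnion_range_polarLine {r : ℝ} (hr : 0 ≤ r) (a b : ℝ) :
    (⋃ θ₀ : ℝ, ⋃ φ₀ : ℝ, range (polarLine r θ₀ φ₀ a b)) = level r := by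
  ext m
  simp only [mem_iUnion]
  constructor
  · rintro ⟨θ₀, φ₀, t, rfl⟩
    exact polarLine_mem_level hr _ _ _ _ _
  · intro hm
    obtain ⟨θ₀, φ₀, h⟩ := exists_polar_of_mem_level hm
    exact ⟨θ₀, φ₀, 0, h a b⟩

/-- These lines are orbits of a constant-coefficient flow, so two that meet agree up to a time
shift. -/
lemma range_polarLine_eq_or_disjoint {r : ℝ} (hr : 0 ≤ r) (a b θ₀ φ₀ θ₁ φ₁ : ℝ) :
    range (polarLine r θ₀ φ₀ a b) = range (polarLine r θ₁ φ₁ a b) ∨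
      Disjoint (range (polarLine r θ₀ φ₀ a b)) (range (polarLine r θ₁ φ₁ a b)) := by
  have hflow (θ φ s t : ℝ) : polarLine r θ φ a b (s + t) =
      rotFlow (fun _ => a) (fun _ => -b) t (polarLine r θ φ a b s) := by
    simpa using (rotFlow_polarLine (fun _ => a) (fun _ => -b) hr θ φ s t).symm
  have hsub (θ φ θ' φ' s s' : ℝ) (h : polarLine r θ φ a b s = polarLine r θ' φ' a b s') :
      range (polarLine r θ φ a b) ⊆ range (polarLine r θ' φ' a b) := by
    rintro _ ⟨t, rfl⟩
    refine ⟨s' + (t - s), ?_⟩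
    rw [hflow, ← h, ← hflow, add_sub_cancel]
  refine or_iff_not_imp_right.2 fun hd => ?_
  obtain ⟨_, ⟨s, rfl⟩, s', hs⟩ := not_disjoint_iff.1 hd
  exact (hsub _ _ _ _ _ _ hs.symm).antisymm (hsub _ _ _ _ _ _ hs)

/-! ### Morse-Bott tori -/

lemma cos_eq_one_of_rotFlow_eq {a b : ℝ → ℝ} {T : ℝ} {m : M} (hm : 0 < radius m)
    (h : rotFlow a b T m = m) :
    Real.cos (b (radius m) * T) = 1 ∧ Real.sin (b (radius m) * T) = 0 := by
  have h1 : Real.cos (b (radius m) * T) * m.2.1 + Real.sin (b (radius m) * T) * m.2.2 = m.2.1 :=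
    congrArg (fun m : M => m.2.1) h
  have h2 : Real.cos (b (radius m) * T) * m.2.2 - Real.sin (b (radius m) * T) * m.2.1 = m.2.2 :=
    congrArg (fun m : M => m.2.2) h
  have h3 := radius_sq m
  have h4 : radius m ^ 2 ≠ 0 := by positivity
  refine ⟨mul_right_cancel₀ h4 ?_, mul_right_cancel₀ h4 ?_⟩
  · rw [h3]; linear_combination m.2.1 * h1 + m.2.2 * h2
  · rw [h3]; linear_combination m.2.2 * h1 - m.2.1 * h2

lemma isMorseBottTorus_level_iff {a b : ℝ → ℝ} {a' b' r T : ℝ} (hr : 0 < r)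
    (ha : HasDerivAt a a' r) (hb : HasDerivAt b b' r) (hT : 0 < T)
    (hp : ∀ m ∈ level r, rotFlow a b T m = m) :
    IsMorseBottTorus (rotField a b) (rotFlow a b) (level r) ↔ a' ≠ 0 ∨ b' ≠ 0 := by
  -- Stated for every return time `S`, since the Morse-Bott condition supplies an unspecified one.
  -- The map A - 1 is a shear proportional to the radial part of v, so its kernel is the tangent
  -- plane or everything.
  have key : ∀ S : ℝ, 0 < S → ∀ m ∈ level r, rotFlow a b S m = m →
      ∃ A : TM →L[ℝ] TM, HasDifferentialAt (rotFlow a b S) A m ∧ ∀ v, A v = v ↔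
        (a' = 0 ∧ b' = 0) ∨ m.2.1 * v.2.1 + m.2.2 * v.2.2 = 0 := by
    intro S hS m hm hSm
    have hm' : radius m = r := hm
    obtain ⟨hc, hs⟩ := cos_eq_one_of_rotFlow_eq (hm'.symm ▸ hr) hSm
    obtain ⟨A, hA, hAv⟩ := exists_hasDifferentialAt_rotFlow (hm'.symm ▸ hr) (hm'.symm ▸ ha)
      (hm'.symm ▸ hb) S
    refine ⟨A, hA, fun v => ?_⟩
    rw [hAv, hc, hs, hSm, hm']
    set N := m.2.1 * v.2.1 + m.2.2 * v.2.2 with hN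
    have hxy := (radius_eq_iff hr.le).1 hm'
    constructor
    · intro h
      have e1 : v.1 + S * a' * (N / r) = v.1 := congrArg Prod.fst h
      have e2 : 1 * v.2.1 + 0 * v.2.2 + S * b' * (N / r) * m.2.2 = v.2.1 :=
        congrArg (fun m => m.2.1) h
      have e3 : 1 * v.2.2 - 0 * v.2.1 - S * b' * (N / r) * m.2.1 = v.2.2 :=
        congrArg (fun m => m.2.2) h
      by_cases hN0 : N = 0
      · exact Or.inr hN0
      · refine Or.inl ⟨?_, ?_⟩
        · have : S * (N / r) * a' = 0 := by linear_combination e1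
          simpa [hS.ne', hN0, hr.ne'] using this
        · have : S * (N / r) * r ^ 2 * b' = 0 := by
            linear_combination m.2.2 * e2 - m.2.1 * e3 - S * b' * (N / r) * hxy
          simpa [hS.ne', hN0, hr.ne'] using this
    · rintro (⟨h1, h2⟩ | h)
      · simp [h1, h2]
      · simp [h]
  constructor
  · rintro ⟨-, -, S, hS, h⟩
    by_contra! hab
    have hm := polarLine_mem_level hr.le 0 0 0 0 0
    set m := polarLine r 0 0 0 0 0
    obtain ⟨hSm, A, hA, hker⟩ := h m hm
    obtain ⟨B, hB, hBv⟩ := key S hS m hm hSm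
    obtain rfl := hA.unique hB
    -- With both derivatives zero the kernel is everything, including this radial vector, which is
    -- not tangent to the torus.
    have h1 : ((0, m.2) : TM) ∈ tangentVectors (level r) m := by
      rw [hker]
      exact (hBv _).2 (Or.inl hab)
    rw [tangentVectors_level hr hm] at h1
    have h2 : m.2.1 * m.2.1 + m.2.2 * m.2.2 = 0 := h1
    have h3 := (radius_eq_iff hr.le).1 hm
    have h4 : 0 < r ^ 2 := by positivity
    linarith
  · intro hab
    refine ⟨isEmbeddedTorus_level hr, fun m hm => ?_, T, hT, fun m hm => ⟨hp m hm, ?_⟩⟩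
    · rw [tangentVectors_level hr hm, mem_ofPred_eq, rotField]
      ring
    · obtain ⟨A, hA, hAv⟩ := key T hT m hm (hp m hm)
      refine ⟨A, hA, ?_⟩
      rw [tangentVectors_level hr hm]
      ext v
      simp only [mem_ofPred_eq, hAv]
      tauto

/-! ### Slope criterion and period on a rational torus -/

namespace IsContactData

variable {f g : ℝ → ℝ}

lemma f_mul_reebA_sub (h : IsContactData f g) {ρ : ℝ} (hρ : 0 < ρ) :
    f ρ * reebA f g ρ - g ρ * reebB f g ρ = 1 := by
  have := (h.wronskian_pos ρ hρ).ne'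
  rw [h.reebA_eq hρ, h.reebB_eq hρ]
  field_simp
  rw [wronskian]
  ring

/-- Differentiate λ(X) = 1; the terms f'a and g'b cancel, both being f'g'/D. -/
lemma f_mul_deriv_reebA (h : IsContactData f g) {r : ℝ} (hr : 0 < r) :
    f r * deriv (reebA f g) r - g r * deriv (reebB f g) r = 0 := by
  have h1 := ((h.differentiableAt_f hr).hasDerivAt.mul (h.differentiableAt_reebA hr).hasDerivAt).sub
    ((h.differentiableAt_g hr).hasDerivAt.mul (h.differentiableAt_reebB hr).hasDerivAt)
  have h2 : (f * reebA f g - g * reebB f g) =ᶠ[𝓝 r] fun _ => (1 : ℝ) := by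
    filter_upwards [lt_mem_nhds hr] with ρ hρ
    exact h.f_mul_reebA_sub hρ
  have h3 := h1.unique ((hasDerivAt_const r (1 : ℝ)).congr_of_eventuallyEq h2)
  have h4 : deriv f r * reebA f g r = deriv g r * reebB f g r := by
    rw [h.reebA_eq hr, h.reebB_eq hr]
    ring
  linarith

/-- The numerator of (b/a)' is the determinant of (a, b) and (a', b'). As (F, -G) kills (a', b') but
pairs to 1 with (a, b), these vectors are parallel only if (a', b') = 0. -/
lemma deriv_quotient_ne_zero_iff {a b : ℝ → ℝ} {F G a' b' r : ℝ} (ha : HasDerivAt a a' r)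
    (hb : HasDerivAt b b' r) (ha0 : a r ≠ 0) (h1 : F * a r - G * b r = 1)
    (h2 : F * a' - G * b' = 0) :
    deriv (fun ρ => b ρ / a ρ) r ≠ 0 ↔ a' ≠ 0 ∨ b' ≠ 0 := by
  rw [(hb.fun_div ha ha0).deriv, ← not_and_or, not_iff_not, div_eq_zero_iff,
    or_iff_left (pow_ne_zero 2 ha0)]
  constructor
  · intro h
    constructor
    · linear_combination -a' * h1 + a r * h2 + G * h
    · linear_combination -b' * h1 + b r * h2 + F * h
  · rintro ⟨h, h'⟩
    rw [h, h']
    ring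

lemma deriv_f_div_g (h : IsContactData f g) {r : ℝ} (hr : 0 < r) :
    deriv (fun ρ => deriv f ρ / deriv g ρ) r = deriv (fun ρ => reebB f g ρ / reebA f g ρ) r := by
  apply EventuallyEq.deriv_eq
  filter_upwards [lt_mem_nhds hr] with ρ hρ
  rw [h.reebA_eq hρ, h.reebB_eq hρ, div_div_div_cancel_right₀ (h.wronskian_pos ρ hρ).ne']

lemma deriv_g_div_f (h : IsContactData f g) {r : ℝ} (hr : 0 < r) :
    deriv (fun ρ => deriv g ρ / deriv f ρ) r = deriv (fun ρ => reebA f g ρ / reebB f g ρ) r := by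
  apply EventuallyEq.deriv_eq
  filter_upwards [lt_mem_nhds hr] with ρ hρ
  rw [h.reebA_eq hρ, h.reebB_eq hρ, div_div_div_cancel_right₀ (h.wronskian_pos ρ hρ).ne']

lemma exists_period (h : IsContactData f g) {r : ℝ} (hr : 0 < r) {p q : ℤ}
    (hp : SignType.sign p = SignType.sign (deriv f r))
    (hq : SignType.sign q = SignType.sign (deriv g r))
    (hpq : deriv f r * q = 2 * Real.pi * deriv g r * p) :
    ∃ T : ℝ, 0 < T ∧
      (deriv g r ≠ 0 → T = q * (wronskian f g r / deriv g r)) ∧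
      (deriv f r ≠ 0 → T = 2 * Real.pi * p * (wronskian f g r / deriv f r)) ∧
      deriv g r / wronskian f g r = q / T ∧
      deriv f r / wronskian f g r = 2 * Real.pi * p / T := by
  have hD := h.wronskian_pos r hr
  have hpi := Real.pi_pos
  have pos_div : ∀ {n : ℤ} {x : ℝ}, SignType.sign n = SignType.sign x → x ≠ 0 → 0 < n / x := by
    intro n x hs hx
    rcases hx.lt_or_gt with hx | hx
    · rw [sign_neg hx, sign_eq_neg_one_iff] at hs
      exact div_pos_of_neg_of_neg (by exact_mod_cast hs) hx
    · rw [sign_pos hx, sign_eq_one_iff] at hs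
      exact div_pos (by exact_mod_cast hs) hx
  by_cases hg : deriv g r = 0
  · have hf : deriv f r ≠ 0 := by
      intro hf
      simp [wronskian, hf, hg] at hD
    have hq0 : q = 0 := by simpa [hg, sign_eq_zero_iff] using hq
    have hpf := pos_div hp hf
    have hp0 : (p : ℝ) ≠ 0 := (div_ne_zero_iff.1 hpf.ne').1
    refine ⟨2 * Real.pi * p * (wronskian f g r / deriv f r), ?_, fun h => absurd hg h, fun _ => rfl,
      by simp [hg, hq0], ?_⟩
    · have : 2 * Real.pi * p * (wronskian f g r / deriv f r) =
        2 * Real.pi * wronskian f g r * (p / deriv f r) := by ring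
      rw [this]
      positivity
    · field_simp
  · have hqg := pos_div hq hg
    have hq0 : (q : ℝ) ≠ 0 := (div_ne_zero_iff.1 hqg.ne').1
    refine ⟨q * (wronskian f g r / deriv g r), ?_, fun _ => rfl, fun hf => ?_, ?_, ?_⟩
    · have : q * (wronskian f g r / deriv g r) = wronskian f g r * (q / deriv g r) := by ring
      rw [this]
      positivity
    · field_simp
      linear_combination hpq
    · field_simp
    · field_simp
      linear_combination hpq

end IsContactData

end SymOrbits

namespace SymOrbits

/-! ### Conley-Zehnder index of a path of rotations -/

/-- The rotation of `ℝ²` by the angle `x`. -/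
noncomputable def rotMatrix (x : ℝ) : Matrix (Fin 2) (Fin 2) ℝ :=
  !![Real.cos x, -Real.sin x; Real.sin x, Real.cos x]

lemma rotMatrix_mulVec_polar (x R ψ : ℝ) :
    (rotMatrix x).mulVec ![R * Real.cos ψ, R * Real.sin ψ] =
      ![R * Real.cos (x + ψ), R * Real.sin (x + ψ)] := by
  ext i
  fin_cases i
  · simp [rotMatrix, Matrix.mulVec, dotProduct, Fin.sum_univ_two, Real.cos_add]
    ring
  · simp [rotMatrix, Matrix.mulVec, dotProduct, Fin.sum_univ_two, Real.sin_add]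
    ring

lemma exists_polar_of_ne_zero {z : Fin 2 → ℝ} (hz : z ≠ 0) :
    ∃ R ψ : ℝ, 0 < R ∧ z = ![R * Real.cos ψ, R * Real.sin ψ] := by
  refine ⟨‖(⟨z 0, z 1⟩ : ℂ)‖, (⟨z 0, z 1⟩ : ℂ).arg, norm_pos_iff.2 fun h => hz ?_, ?_⟩
  · ext i
    fin_cases i
    · exact congrArg Complex.re h
    · exact congrArg Complex.im h
  · rw [Complex.norm_mul_cos_arg, Complex.norm_mul_sin_arg]
    ext i
    fin_cases i <;> rfl

lemma exists_int_of_polar_eq {s R x y : ℝ} (hs : 0 < s) (hR : 0 < R)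
    (hc : s * Real.cos x = R * Real.cos y) (hsn : s * Real.sin x = R * Real.sin y) :
    ∃ n : ℤ, n * (2 * Real.pi) = x - y := by
  have h1 : s ^ 2 = R ^ 2 := by
    linear_combination (-s ^ 2) * Real.sin_sq_add_cos_sq x + R ^ 2 * Real.sin_sq_add_cos_sq y +
      (s * Real.cos x + R * Real.cos y) * hc + (s * Real.sin x + R * Real.sin y) * hsn
  obtain rfl : s = R := (sq_eq_sq₀ hs.le hR.le).1 h1
  refine (Real.cos_eq_one_iff _).1 ?_
  rw [Real.cos_sub, mul_left_cancel₀ hs.ne' hc, mul_left_cancel₀ hs.ne' hsn]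
  linear_combination Real.sin_sq_add_cos_sq y

lemma eq_of_continuousOn_of_int {c : ℝ → ℝ} {T : ℝ} (hT : 0 ≤ T) (hc : ContinuousOn c (Icc 0 T))
    (hi : ∀ t ∈ Icc 0 T, ∃ n : ℤ, c t = n) : c T = c 0 := by
  refine isPreconnected_Icc.constant_of_mapsTo (T := range ((↑) : ℤ → ℝ)) ?_ hc
    (fun t ht => ?_) (right_mem_Icc.2 hT) (left_mem_Icc.2 hT)
  · exact Int.isClosedEmbedding_coe_real.isEmbedding.isInducing.isDiscrete_range
  · obtain ⟨n, hn⟩ := hi t ht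
    exact ⟨n, hn.symm⟩

/-- Any continuous argument differs from κt + ψ by a continuous function with values in 2πℤ, hence
by a constant. Nonemptiness is not needed for an odd index. -/
lemma windingSet_rotMatrix_subset (κ : ℝ) {T : ℝ} (hT : 0 ≤ T) :
    windingSet (fun t => rotMatrix (κ * t)) T ⊆ {κ * T / (2 * Real.pi)} := by
  rintro w ⟨z, hz, s, a, ha, hsa, rfl⟩
  obtain ⟨R, ψ, hR, rfl⟩ := exists_polar_of_ne_zero hz
  have hpi := Real.pi_ne_zero
  have h := eq_of_continuousOn_of_int (c := fun t => (a t - (κ * t + ψ)) / (2 * Real.pi)) hT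
    ((ha.sub (by fun_prop)).div_const _) (fun t ht => by
      obtain ⟨hs, he⟩ := hsa t ht
      rw [rotMatrix_mulVec_polar] at he
      have h0 := congrFun he 0
      have h1 := congrFun he 1
      simp only [Matrix.cons_val_zero, Matrix.cons_val_one] at h0 h1
      obtain ⟨n, hn⟩ := exists_int_of_polar_eq hs hR h0.symm h1.symm
      refine ⟨n, ?_⟩
      rw [← hn]
      field_simp)
  rw [mem_singleton_iff]
  field_simp at h ⊢
  linarith

lemma isCZIndexOfPath_rotMatrix {κ T x : ℝ} (hT : 0 ≤ T) (hx : κ * T = 2 * Real.pi * x)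
    (hn : ¬ ∃ n : ℤ, x = n) :
    IsCZIndexOfPath (fun t => rotMatrix (κ * t)) T (2 * ⌊x⌋ + 1) := by
  have hpi := Real.pi_ne_zero
  refine ⟨?_, ?_, fun t _ => ?_, ?_, ⌊x⌋, Or.inr ⟨fun w hw => ?_, rfl⟩⟩
  · refine Continuous.continuousOn (continuous_matrix fun i j => ?_)
    fin_cases i <;> fin_cases j <;> simp [rotMatrix] <;> fun_prop
  · simp [rotMatrix, Matrix.one_fin_two]
  · simp only [rotMatrix, Matrix.det_fin_two_of]
    linear_combination Real.sin_sq_add_cos_sq (κ * t)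
  · intro h
    have h1 : Real.cos (κ * T) = 1 := by
      simp only [rotMatrix, Matrix.one_fin_two, Matrix.det_fin_two, Matrix.sub_apply,
        Matrix.of_apply, Matrix.cons_val', Matrix.cons_val_zero, Matrix.cons_val_one,
        Matrix.cons_val_fin_one] at h
      -- For a rotation R by angle y, det(R - 1) = 2 - 2 cos y.
      linear_combination (-1 / 2) * h + (1 / 2) * Real.sin_sq_add_cos_sq (κ * T)
    obtain ⟨n, hn'⟩ := (Real.cos_eq_one_iff _).1 h1
    refine hn ⟨n, ?_⟩
    rw [hx] at hn'
    have : 2 * Real.pi * (x - n) = 0 := by linarith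
    have h2 : x - n = 0 := by simpa [hpi] using this
    linarith
  · have hw' : w = x := by
      rw [mem_singleton_iff.1 (windingSet_rotMatrix_subset κ hT hw), hx]
      field_simp
    rw [hw']
    exact ⟨(Int.floor_le x).lt_of_ne fun h => hn ⟨_, h.symm⟩, Int.lt_floor_add_one x⟩

/-! ### The central orbit -/

section Center

variable {f g : ℝ → ℝ} {m : M}

lemma rotFlow_center (a b : ℝ → ℝ) (hm : radius m = 0) (t : ℝ) :
    rotFlow a b t m = (m.1 + ((a 0 * t : ℝ) : AddCircle (1 : ℝ)), 0, 0) := by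
  simp [rotFlow, hm, radius_eq_zero_iff.1 hm]

lemma radius_rotFlow_center (a b : ℝ → ℝ) (hm : radius m = 0) (t : ℝ) :
    radius (rotFlow a b t m) = 0 := by
  rw [rotFlow_center a b hm, radius_eq_zero_iff]
  rfl

lemma range_rotFlow_center {a b : ℝ → ℝ} (ha : a 0 ≠ 0) (hm : radius m = 0) :
    range (fun t => rotFlow a b t m) = level 0 := by
  ext n
  constructor
  · rintro ⟨t, rfl⟩
    exact radius_rotFlow_center a b hm t
  · intro hn
    obtain ⟨t, ht⟩ := QuotientAddGroup.mk_surjective (n.1 - m.1)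
    refine ⟨t / a 0, ?_⟩
    have h1 : ((t : ℝ) : AddCircle (1 : ℝ)) = n.1 - m.1 := ht
    have h2 : n.2 = 0 := radius_eq_zero_iff.1 hn
    simp only [rotFlow_center a b hm, mul_div_cancel₀ t ha, h1, add_sub_cancel]
    exact Prod.ext rfl h2.symm

lemma isMinimalPeriod_rotFlow_center {a b : ℝ → ℝ} (ha : a 0 ≠ 0) (hm : radius m = 0) :
    IsMinimalPeriod (fun t => rotFlow a b t m) |1 / a 0| := by
  refine ⟨by positivity, fun t => ?_, fun S hS h => ?_⟩
  · simp only [rotFlow_center a b hm, mul_add, AddCircle.coe_add]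
    have : ((a 0 * |1 / a 0| : ℝ) : AddCircle (1 : ℝ)) = 0 := by
      rw [AddCircle.coe_eq_zero_iff]
      rcases abs_choice (1 / a 0) with h | h <;> rw [h]
      · exact ⟨1, by simp [ha]⟩
      · exact ⟨-1, by simp [ha]⟩
    rw [this, add_zero]
  · have h0 := congrArg Prod.fst (h 0)
    simp only [rotFlow_center a b hm, mul_zero, zero_add, add_right_inj] at h0
    obtain ⟨n, hn⟩ := (AddCircle.coe_eq_zero_iff (1 : ℝ)).1 (h0.trans (by simp))
    have hn' : (n : ℝ) = a 0 * S := by simpa using hn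
    have h1 : (n : ℝ) ≠ 0 := by rw [hn']; positivity
    have h2 : (1 : ℝ) ≤ |(n : ℝ)| := by exact_mod_cast Int.one_le_abs (by exact_mod_cast h1)
    rw [hn', abs_mul, abs_of_pos hS] at h2
    rw [abs_div, abs_one, div_le_iff₀ (abs_pos.2 ha)]
    linarith

lemma symForm_center (hm : radius m = 0) (v : TM) : symForm f g m v = f 0 * v.1 := by
  simp [symForm, hm, radius_eq_zero_iff.1 hm]

namespace IsContactData

/-- In the frame `coordFrame (g''(0))`, the linearized Reeb flow at the center rotates with
this angular velocity. -/
lemma angle_eq (h : IsContactData f g) (k : ℕ) :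
    -(SignType.sign (secondDerivZero g) * reebB f g 0) * (k * |f 0|) =
      2 * Real.pi * -(k * secondDerivZero f / (2 * Real.pi * secondDerivZero g)) := by
  have h0 := h.center_pos
  have h1 := h.f_zero_ne
  have h2 := h.secondDerivZero_g_ne
  have hpi := Real.pi_ne_zero
  rw [h.reebB_zero]
  -- Since f(0)g''(0) > 0, the two factors share a sign and sgn(g''(0)) |f(0)| = f(0).
  rcases h2.lt_or_gt with hg | hg
  · have hf : f 0 < 0 := by
      by_contra! hf
      exact (mul_nonpos_of_nonneg_of_nonpos hf hg.le).not_gt h0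
    rw [sign_neg hg, abs_of_neg hf, SignType.coe_neg, SignType.coe_one]
    field_simp
  · have hf : 0 < f 0 := pos_of_mul_pos_left h0 hg.le
    rw [sign_pos hg, abs_of_pos hf, SignType.coe_one]
    field_simp

lemma cos_reebB (h : IsContactData f g) (k : ℕ) :
    Real.cos (reebB f g 0 * (k * |f 0|)) =
      Real.cos (2 * Real.pi * (k * secondDerivZero f / (2 * Real.pi * secondDerivZero g))) := by
  rw [← Real.cos_neg (2 * Real.pi * _), ← mul_neg, ← h.angle_eq k]
  rcases h.secondDerivZero_g_ne.lt_or_gt with hg | hg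
  · rw [sign_neg hg]
    simp
  · rw [sign_pos hg, SignType.coe_one, one_mul, neg_mul, Real.cos_neg]

lemma isDegenerate_iff (h : IsContactData f g) (hm : radius m = 0) (k : ℕ) :
    IsDegenerate (symForm f g) (rotFlow (reebA f g) (reebB f g)) m (k * |f 0|) ↔
      ∃ n : ℤ, k * secondDerivZero f / (2 * Real.pi * secondDerivZero g) = n := by
  have hpi := Real.pi_ne_zero
  have hcos : Real.cos (reebB f g 0 * (k * |f 0|)) = 1 ↔
      ∃ n : ℤ, k * secondDerivZero f / (2 * Real.pi * secondDerivZero g) = n := by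
    rw [h.cos_reebB, Real.cos_eq_one_iff]
    refine exists_congr fun n => ?_
    rw [mul_comm (n : ℝ), mul_right_inj' (mul_ne_zero two_ne_zero hpi), eq_comm]
  rw [← hcos]
  obtain ⟨A, hA, hAv⟩ := exists_hasDifferentialAt_rotFlow_center hm h.hasDerivAt_reebA_zero
    h.continuousAt_reebB_zero (k * |f 0|)
  set x := reebB f g 0 * (k * |f 0|)
  constructor
  · rintro ⟨B, hB, v, h1, h2, h3⟩
    obtain rfl := hA.unique hB
    rw [symForm_center hm, mul_eq_zero, or_iff_right h.f_zero_ne] at h1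
    rw [hAv] at h3
    have e1 : Real.cos x * v.2.1 + Real.sin x * v.2.2 = v.2.1 := congrArg (fun v => v.2.1) h3
    have e2 : Real.cos x * v.2.2 - Real.sin x * v.2.1 = v.2.2 := congrArg (fun v => v.2.2) h3
    -- Pairing the fixed-point equation with v leaves only the cosine; v lies in the contact plane,
    -- so its θ-part is already zero.
    have e3 : (Real.cos x - 1) * (v.2.1 ^ 2 + v.2.2 ^ 2) = 0 := by
      linear_combination v.2.1 * e1 + v.2.2 * e2
    rcases mul_eq_zero.1 e3 with e | e
    · linarith
    · exact absurd (Prod.ext h1 (Prod.ext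
        (by simp only [Prod.snd_zero, Prod.fst_zero]; nlinarith [sq_nonneg v.2.1, sq_nonneg v.2.2])
        (by simp only [Prod.snd_zero]; nlinarith [sq_nonneg v.2.1, sq_nonneg v.2.2]))) h2
  · intro hx
    have hs : Real.sin x = 0 := by
      have := Real.sin_sq_add_cos_sq x
      rw [hx] at this
      simpa using this
    refine ⟨A, hA, (0, 1, 0), ?_, ?_, ?_⟩
    · rw [symForm_center hm, mul_zero]
    · simp
    · rw [hAv, hx, hs]
      simp

lemma isSymplecticFrame_coordFrame (h : IsContactData f g) {γ : ℝ → M}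
    (hγ : ∀ t, radius (γ t) = 0) (T : ℝ) :
    IsSymplecticFrame (symForm f g) γ T (coordFrame (secondDerivZero g)) := by
  refine ⟨continuous_const, fun _ => rfl, fun t => ⟨fun i => ?_, ?_⟩⟩
  · rw [symForm_center (hγ t)]
    fin_cases i <;> simp [coordFrame]
  · have h2 := h.secondDerivZero_g_ne
    have h3 : √|secondDerivZero g| ≠ 0 := by positivity
    rw [h.dForm_symForm, hγ t, ← secondDerivZero_eq h.contDiff_g]
    simp [coordFrame, radius_eq_zero_iff.1 (hγ t)]
    field_simp

/-- The flow turns the (x, y)-plane by -b₀t. If c < 0 the second frame vector is reversed, and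
conjugation by a reflection flips the angle, whence the factor sgn(c). -/
lemma linearized_flow_coordFrame {c b₀ t : ℝ} (hc : c ≠ 0) {A : TM →L[ℝ] TM}
    (hA : ∀ v, A v = (v.1, Real.cos (b₀ * t) * v.2.1 + Real.sin (b₀ * t) * v.2.2,
        Real.cos (b₀ * t) * v.2.2 - Real.sin (b₀ * t) * v.2.1)) (j : Fin 2) :
    A (coordFrame c 0 j) =
      ∑ i, rotMatrix (-(SignType.sign c * b₀) * t) i j • coordFrame c t i := by
  have h0 : √|c| ≠ 0 := by positivity
  have h1 : √|c| * √|c| = |c| := Real.mul_self_sqrt (abs_nonneg c)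
  rcases hc.lt_or_gt with hc' | hc'
  · rw [abs_of_neg hc'] at h0 h1
    fin_cases j <;>
      simp [hA, coordFrame, Fin.sum_univ_two, rotMatrix, sign_neg hc', abs_of_neg hc'] <;>
      field_simp <;> simp [pow_two, h1]
  · rw [abs_of_pos hc'] at h0 h1
    fin_cases j <;>
      simp [hA, coordFrame, Fin.sum_univ_two, rotMatrix, sign_pos hc', abs_of_pos hc'] <;>
      field_simp <;> simp [pow_two, h1]

lemma hasCZIndex_center (h : IsContactData f g) (hm : radius m = 0) {k : ℕ} (hk : 1 ≤ k)
    (hn : ¬ ∃ n : ℤ, k * secondDerivZero f / (2 * Real.pi * secondDerivZero g) = n) :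
    HasCZIndex (symForm f g) (rotFlow (reebA f g) (reebB f g)) m (k * |f 0|)
      (coordFrame (secondDerivZero g))
      (2 * ⌊-(k * secondDerivZero f / (2 * Real.pi * secondDerivZero g))⌋ + 1) := by
  have hf := h.f_zero_ne
  have hk' : (0 : ℝ) < k := by exact_mod_cast hk
  have hT : 0 < k * |f 0| := by positivity
  have ha : reebA f g 0 ≠ 0 := by
    rw [h.reebA_zero]
    exact one_div_ne_zero hf
  have hp := (isMinimalPeriod_rotFlow_center (b := reebB f g) ha hm).2.1
  rw [h.reebA_zero, one_div_one_div] at hp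
  refine ⟨hT, hp.nat_mul k,
    h.isSymplecticFrame_coordFrame (radius_rotFlow_center _ _ hm) _,
    fun t => rotMatrix (-(SignType.sign (secondDerivZero g) * reebB f g 0) * t), fun t _ => ?_,
    isCZIndexOfPath_rotMatrix hT.le (h.angle_eq k) ?_⟩
  · obtain ⟨A, hA, hAv⟩ := exists_hasDifferentialAt_rotFlow_center hm h.hasDerivAt_reebA_zero
      h.continuousAt_reebB_zero t
    exact ⟨A, hA, linearized_flow_coordFrame h.secondDerivZero_g_ne hAv⟩
  · rintro ⟨n, hn'⟩
    exact hn ⟨-n, by push_cast; linarith⟩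

end IsContactData

end Center

end SymOrbits

/-! ### The proposition itself -/

theorem proposition4p8 (f g : ℝ → ℝ) (hfg : SymOrbits.IsContactData f g) :
    -- the Reeb vector field and its flow exist and are unique
    (∃! X, SymOrbits.IsReebField (SymOrbits.symForm f g) X) ∧
    ∀ X, SymOrbits.IsReebField (SymOrbits.symForm f g) X →
    (∃! φ, SymOrbits.IsFlow X φ) ∧
    ∀ φ, SymOrbits.IsFlow X φ →
    -- the tori with rational slope
    (∀ r : ℝ, 0 < r → ∀ p q : ℤ, IsCoprime p q →
      SignType.sign p = SignType.sign (deriv f r) →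
      SignType.sign q = SignType.sign (deriv g r) →
      deriv f r * q = 2 * Real.pi * deriv g r * p →
      SymOrbits.IsEmbeddedTorus (SymOrbits.level r) ∧
      (∃ T : ℝ, 0 < T ∧
        (deriv g r ≠ 0 → T = q * (SymOrbits.wronskian f g r / deriv g r)) ∧
        (deriv f r ≠ 0 → T = 2 * Real.pi * p * (SymOrbits.wronskian f g r / deriv f r)) ∧
        deriv g r / SymOrbits.wronskian f g r = q / T ∧
        -(deriv f r / SymOrbits.wronskian f g r) = -(2 * Real.pi * p / T) ∧
        (∀ θ₀ φ₀ : ℝ,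
          SymOrbits.IsOrbit X (SymOrbits.polarLine r θ₀ φ₀ (q / T) (-(2 * Real.pi * p / T))) ∧
          SymOrbits.IsMinimalPeriod
            (SymOrbits.polarLine r θ₀ φ₀ (q / T) (-(2 * Real.pi * p / T))) T) ∧
        -- the images of these orbits partition the torus
        (⋃ θ₀ : ℝ, ⋃ φ₀ : ℝ,
          Set.range (SymOrbits.polarLine r θ₀ φ₀ (q / T) (-(2 * Real.pi * p / T)))) =
            SymOrbits.level r ∧
        (∀ θ₀ φ₀ θ₁ φ₁ : ℝ,
          Set.range (SymOrbits.polarLine r θ₀ φ₀ (q / T) (-(2 * Real.pi * p / T))) =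
            Set.range (SymOrbits.polarLine r θ₁ φ₁ (q / T) (-(2 * Real.pi * p / T))) ∨
          Disjoint (Set.range (SymOrbits.polarLine r θ₀ φ₀ (q / T) (-(2 * Real.pi * p / T))))
            (Set.range (SymOrbits.polarLine r θ₁ φ₁ (q / T) (-(2 * Real.pi * p / T)))))) ∧
      -- the Morse-Bott criterion
      (deriv g r ≠ 0 →
        (SymOrbits.IsMorseBottTorus X φ (SymOrbits.level r) ↔
          deriv (fun ρ => deriv f ρ / deriv g ρ) r ≠ 0)) ∧
      (deriv f r ≠ 0 →
        (SymOrbits.IsMorseBottTorus X φ (SymOrbits.level r) ↔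
          deriv (fun ρ => deriv g ρ / deriv f ρ) r ≠ 0))) ∧
    -- the central circle and its covers
    (∀ m ∈ SymOrbits.level 0,
      Set.range (fun t => φ t m) = SymOrbits.level 0 ∧
      SymOrbits.IsMinimalPeriod (fun t => φ t m) |f 0| ∧
      ∀ k : ℕ, 1 ≤ k →
        (SymOrbits.IsDegenerate (SymOrbits.symForm f g) φ m (k * |f 0|) ↔
          ∃ n : ℤ, k * SymOrbits.secondDerivZero f /
            (2 * Real.pi * SymOrbits.secondDerivZero g) = n) ∧
        ((¬ ∃ n : ℤ, k * SymOrbits.secondDerivZero f /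
            (2 * Real.pi * SymOrbits.secondDerivZero g) = n) →
          SymOrbits.HasCZIndex (SymOrbits.symForm f g) φ m (k * |f 0|)
            (SymOrbits.coordFrame (SymOrbits.secondDerivZero g))
            (2 * ⌊-(k * SymOrbits.secondDerivZero f /
              (2 * Real.pi * SymOrbits.secondDerivZero g))⌋ + 1))) := by
  have hReeb := fun X => hfg.isReebField_iff (X := X)
  refine ⟨⟨_, (hReeb _).2 rfl, fun X hX => (hReeb X).1 hX⟩, fun X hX => ?_⟩
  obtain rfl := (hReeb X).1 hX
  refine ⟨⟨_, SymOrbits.isFlow_rotFlow _ _, fun φ hφ => hφ.eq_rotFlow⟩, fun φ hφ => ?_⟩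
  obtain rfl := hφ.eq_rotFlow
  refine ⟨fun r hr p q hpq hp hq hslope => ?_, fun m hm => ?_⟩
  · obtain ⟨T, hT, hTg, hTf, hga, hfb⟩ := hfg.exists_period hr hp hq hslope
    have hA := (hfg.reebA_eq hr).trans hga
    have hB := (hfg.reebB_eq hr).trans hfb
    -- Every point of the torus lies on a T-periodic line, so T is a return time for the whole
    -- torus.
    have hid : ∀ m ∈ SymOrbits.level r,
        SymOrbits.rotFlow (SymOrbits.reebA f g) (SymOrbits.reebB f g) T m = m := by
      intro m hm
      obtain ⟨θ₀, φ₀, h⟩ := SymOrbits.exists_polar_of_mem_level hm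
      have h1 := SymOrbits.rotFlow_polarLine (SymOrbits.reebA f g) (SymOrbits.reebB f g) hr.le
        θ₀ φ₀ 0 T
      rw [hA, hB, (SymOrbits.isMinimalPeriod_polarLine hr hT hpq θ₀ φ₀).2.1, h] at h1
      exact h1
    have hMB := SymOrbits.isMorseBottTorus_level_iff hr (hfg.differentiableAt_reebA hr).hasDerivAt
      (hfg.differentiableAt_reebB hr).hasDerivAt hT hid
    refine ⟨SymOrbits.isEmbeddedTorus_level hr, ⟨T, hT, hTg, hTf, hga, by rw [hfb],
      fun θ₀ φ₀ => ⟨?_, SymOrbits.isMinimalPeriod_polarLine hr hT hpq θ₀ φ₀⟩,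
      SymOrbits.iUnion_range_polarLine hr.le _ _,
      SymOrbits.range_polarLine_eq_or_disjoint hr.le _ _⟩, fun hg => ?_, fun hf => ?_⟩
    · rw [← hA, ← hB]
      exact SymOrbits.isOrbit_polarLine _ _ hr.le θ₀ φ₀
    · rw [hMB, hfg.deriv_f_div_g hr]
      refine (SymOrbits.IsContactData.deriv_quotient_ne_zero_iff
        (hfg.differentiableAt_reebA hr).hasDerivAt (hfg.differentiableAt_reebB hr).hasDerivAt ?_
        (hfg.f_mul_reebA_sub hr) (hfg.f_mul_deriv_reebA hr)).symm
      rw [hfg.reebA_eq hr]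
      exact div_ne_zero hg (hfg.wronskian_pos r hr).ne'
    · rw [hMB, hfg.deriv_g_div_f hr, or_comm]
      -- With a and b interchanged, fa - gb = 1 reads (-g)b - (-f)a = 1.
      refine (SymOrbits.IsContactData.deriv_quotient_ne_zero_iff (F := -g r) (G := -f r)
        (hfg.differentiableAt_reebB hr).hasDerivAt (hfg.differentiableAt_reebA hr).hasDerivAt ?_
        (by linarith [hfg.f_mul_reebA_sub hr]) (by linarith [hfg.f_mul_deriv_reebA hr])).symm
      rw [hfg.reebB_eq hr]
      exact div_ne_zero hf (hfg.wronskian_pos r hr).ne'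
  · have ha : SymOrbits.reebA f g 0 ≠ 0 := by
      rw [hfg.reebA_zero]
      exact one_div_ne_zero hfg.f_zero_ne
    have hmin := SymOrbits.isMinimalPeriod_rotFlow_center (b := SymOrbits.reebB f g) ha hm
    rw [hfg.reebA_zero, one_div_one_div] at hmin
    exact ⟨SymOrbits.range_rotFlow_center ha hm, hmin, fun k hk =>
      ⟨hfg.isDegenerate_iff hm k, hfg.hasCZIndex_center hm hk⟩⟩
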